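/- For $a\in\mathbb R$ and $k>0$ let $H_{a,k}=\{x+iy\in\mathbb C : x<-k,\ x+\tfrac k2\log(x^2+y^2)<a\}$ (logarithmic half-plane). Let $R\subset[0,\infty)$ be a closed discrete set and $(A_\beta)_{\beta\in R}$ complex numbers. Let $g$ be an irrational series on $H_{a,k}$ with formal development $\sum_{\beta\in R}A_\beta e^{\beta w}$, that is, a bounded holomorphic function on $H_{a,k}$ such that for every $x\in\mathbb R$ $$g(w)-\sum_{\beta\in R,\ \beta<x}A_\beta e^{\beta w}=O(e^{xw})\qquad\text{as }\operatorname{Re}(w)\to-\infty\text{ in }H_{a,k}.$$ Suppose that $R$ has linear density: there are real constants $\mu,\nu$ such that $\#(R\cap I)\le\mu\sup(I)+\nu$ for every interval $I\subset[0,\infty)$ of length $1$. For a finite set $S\subset\mathbb R$ with $\#S=N+1$, let $D_S=\sum_{\beta\in S}d_\beta\delta_\beta$ be the Vandermonde distribution of $S$, i.e. the solution of $\sum_{\beta\in S}\beta^j d_\beta=0$ for $0\le j<N$ and $\sum_{\beta\in S}\beta^N d_\beta=1$; put $\Delta_S=N!\,D_S$ and $\langle\Delta_S,e^{tw}\rangle=N!\sum_{\beta\in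 S}d_\beta e^{\beta w}$. Then there exist finite non-empty sets $R_n\subset[0,\infty)$ ($n\in\mathbb N$) with $\inf R_n=\beta_n$ and $\#R_n=N_n+1$, coefficients $b_n\in\mathbb C$, a radius $r\in(0,1)$, constants $c,a'\in\mathbb R$, and a closed discrete set $R'\subset[0,\infty)$ containing $R$ such that, with $k'=\mu+2k$: 1. $H_{a',k'}\subset H_{a,k}$ and $g(w)=\sum_n b_n\langle\Delta_{R_n},e^{tw}\rangle$ for every $w\in H_{a',k'}$; 2. $\sum_n|b_n|\,r^{\beta_n}<\infty$; 3. $N_n\le(\mu+2k)\beta_n+c$ for all $n$; 4. the formal development of $g$ converges normally by (Vandermonde) packages on $H_{a',k'}$: $\bigcup_nR_n=R'$; for every $\beta\in R'$ the coefficients of $e^{\beta w}$ in the packages $b_n\langle\Delta_{R_n},e^{tw}\rangle$ sum over $n$ to $A_\beta$ if $\beta\in R$ and to $0$ otherwise; and $$\sum_n\ \sup_{w\in H_{a',k'}}\bigl|b_n\langle\Delta_{R_n},e^{tw}\rangle\bigr|<\infty .$$ -/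

import Mathlib

open Set Filter Asymptotics
open scoped Topology ENNReal

namespace IrrationalSeries

noncomputable section

/-- The logarithmic half-plane with parameters `a` and `k`: the part in `Re w < -k` of
`{x + iy | x + (k/2) log (x² + y²) < a}`. What is cut off is bounded. The cut is needed because the
uncut set always contains a punctured disc about `0`, which is a separate component when `a` is
very negative; the set below is stable under `w ↦ w - t` (`t ≥ 0`), and it is exactly the unbounded
component as soon as `a ≤ k log k - k`. -/
def logHalfPlane (a k : ℝ) : Set ℂ :=
  {w | w.re < -k ∧ w.re + k / 2 * Real.log (w.re ^ 2 + w.im ^ 2) < a}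

/-- `R` is a closed discrete subset of `ℝ⁺ = [0, ∞)`. -/
structure IsExponentSet (R : Set ℝ) : Prop where
  isClosed : IsClosed R
  isDiscrete : IsDiscrete R
  nonneg : R ⊆ Ici 0

/-- `g` admits the formal series `∑_{β ∈ R} A_β e^{βw}` as formal development on `H`: for every real
`x`, `g(w) - ∑_{β ∈ R, β < x} A_β e^{βw} = O(e^{xw})` as `Re w → -∞` in `H`. (For `R` unbounded it is
the same to let `x` run through `R` only; for `R` finite that would not control the last term nor
the remainder.) -/
def HasFormalDevelopment (g : ℂ → ℂ) (H : Set ℂ) (R : Set ℝ) (A : ℝ → ℂ) : Prop :=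
  ∀ x : ℝ,
    (fun w : ℂ => g w - ∑ᶠ β ∈ R ∩ Iio x, A β * Complex.exp ((β : ℂ) * w))
      =O[comap Complex.re atBot ⊓ 𝓟 H] fun w : ℂ => Complex.exp ((x : ℂ) * w)

/-- `g` is an irrational series on `H`, with exponents in `R` and coefficients `A`: a bounded
holomorphic function on `H` whose formal development is `∑_{β ∈ R} A_β e^{βw}`. -/
structure IsIrrationalSeries (g : ℂ → ℂ) (H : Set ℂ) (R : Set ℝ) (A : ℝ → ℂ) : Prop where
  holomorphic : DifferentiableOn ℂ g H
  bounded : ∃ C : ℝ, ∀ w ∈ H, ‖g w‖ ≤ C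
  development : HasFormalDevelopment g H R A

/-- Linear density with constants `μ`, `ν`: every interval `I ⊆ ℝ⁺` of length `1` satisfies
`#(R ∩ I) ≤ μ sup I + ν`. -/
def HasLinearDensity (R : Set ℝ) (μ ν : ℝ) : Prop :=
  ∀ x : ℝ, 0 ≤ x → ((R ∩ Icc x (x + 1)).ncard : ℝ) ≤ μ * (x + 1) + ν

/-- The coefficient at `β ∈ S` of the Vandermonde distribution `D_S = ∑_{β ∈ S} d_β δ_β`.
`sum_pow_mul_vandermondeCoeff` and `eq_vandermondeCoeff` show that these are exactly the solution of
the system `D_S(t^j) = 0` for `j < n`, `D_S(t^n) = 1`, where `#S = n + 1`. -/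
def vandermondeCoeff (S : Finset ℝ) (β : ℝ) : ℝ := ∏ γ ∈ S.erase β, (β - γ)⁻¹

theorem sum_eval_mul_vandermondeCoeff (S : Finset ℝ) (n : ℕ) (hS : S.card = n + 1)
    (p : Polynomial ℝ) (hp : p.degree < S.card) :
    ∑ β ∈ S, p.eval β * vandermondeCoeff S β = p.coeff n := by
  have h := Lagrange.coeff_eq_sum (s := S) (v := id) (Set.injOn_id _) (P := p) hp
  rw [hS, Nat.add_sub_cancel] at h
  rw [h]
  refine Finset.sum_congr rfl fun β _ => ?_
  simp [vandermondeCoeff, div_eq_mul_inv]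

theorem sum_pow_mul_vandermondeCoeff (S : Finset ℝ) (n : ℕ) (hS : S.card = n + 1) (j : ℕ)
    (hj : j ≤ n) :
    ∑ β ∈ S, β ^ j * vandermondeCoeff S β = if j = n then 1 else 0 := by
  have h := sum_eval_mul_vandermondeCoeff S n hS (Polynomial.X ^ j) (by
    rw [Polynomial.degree_X_pow, hS]; exact_mod_cast Nat.lt_succ_of_le hj)
  simpa [Polynomial.coeff_X_pow, eq_comm] using h

theorem eq_vandermondeCoeff (S : Finset ℝ) (n : ℕ) (hS : S.card = n + 1) (d : ℝ → ℝ)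
    (hd : ∀ j ≤ n, ∑ β ∈ S, β ^ j * d β = if j = n then 1 else 0) :
    ∀ β ∈ S, d β = vandermondeCoeff S β := by
  intro β hβ
  set p := Lagrange.basis S id β with hp
  have hdeg : p.natDegree < n + 1 := by
    rw [hp, Lagrange.natDegree_basis (Set.injOn_id _) hβ, hS]; lia
  have key : ∀ e : ℝ → ℝ, (∀ j ≤ n, ∑ γ ∈ S, γ ^ j * e γ = if j = n then 1 else 0) →
      e β = p.coeff n := by
    intro e he
    have h1 : ∑ γ ∈ S, p.eval γ * e γ = e β := by
      rw [Finset.sum_eq_single β]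
      · have h := Lagrange.eval_basis_self (s := S) (v := id) (Set.injOn_id _) hβ
        simp only [id] at h
        rw [hp, h, one_mul]
      · intro γ hγ hne
        have h := Lagrange.eval_basis_of_ne (s := S) (v := id) (i := β) (Ne.symm hne) hγ
        simp only [id] at h
        rw [hp, h, zero_mul]
      · exact fun h => absurd hβ h
    rw [← h1]
    simp_rw [Polynomial.eval_eq_sum_range' hdeg, Finset.sum_mul]
    rw [Finset.sum_comm]
    simp_rw [mul_assoc, ← Finset.mul_sum]
    rw [Finset.sum_congr rfl fun j hj => by
      rw [he j (Nat.lt_succ_iff.mp (Finset.mem_range.mp hj))]]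
    simp
  rw [key d hd, key _ (sum_pow_mul_vandermondeCoeff S n hS)]

/-- The coefficient at `β ∈ S` of the normalized Vandermonde distribution `Δ_S = n! D_S`,
`#S = n + 1`. -/
def normalizedVandermondeCoeff (S : Finset ℝ) (β : ℝ) : ℝ :=
  ((S.card - 1).factorial : ℝ) * vandermondeCoeff S β

/-- The package with exponents in `P` and coefficients `c`: `∑_{β ∈ P} c_β e^{βw}`. -/
def package (P : Finset ℝ) (c : ℝ → ℂ) (w : ℂ) : ℂ :=
  ∑ β ∈ P, c β * Complex.exp ((β : ℂ) * w)

/-- The normalized Vandermonde package `⟨Δ_S, e^{tw}⟩`. -/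
def vandermondePackage (S : Finset ℝ) (w : ℂ) : ℂ :=
  package S (fun β => (normalizedVandermondeCoeff S β : ℂ)) w

/-- `P` is a system of packages supported by `R`: finite subsets of `R` (possibly overlapping) with
union `R`. -/
def IsPackageSystem (P : ℕ → Finset ℝ) (R : Set ℝ) : Prop :=
  (⋃ n, (P n : Set ℝ)) = R

/-- The formal sum `∑_n ∑_{β ∈ P_n} c_{n,β} e^{βw}` is a decomposition of `∑_{β ∈ R} A_β e^{βw}`,
viewed as a series with exponents in `R' ⊇ R` (coefficient `0` off `R`), along the system of
packages `P` supported by `R'`. -/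
structure IsDecomposition (P : ℕ → Finset ℝ) (c : ℕ → ℝ → ℂ) (R' R : Set ℝ) (A : ℝ → ℂ) :
    Prop where
  subset : R ⊆ R'
  system : IsPackageSystem P R'
  hasSum : ∀ β ∈ R', HasSum (fun n => (P n : Set ℝ).indicator (c n) β) (R.indicator A β)

/-- Normal convergence by packages on `H`:
`∑_n sup_{w ∈ H} |∑_{β ∈ P_n} c_{n,β} e^{βw}| < ∞`. -/
def ConvergesNormallyByPackages (P : ℕ → Finset ℝ) (c : ℕ → ℝ → ℂ) (H : Set ℂ) : Prop :=
  ∑' n, ⨆ w ∈ H, ‖package (P n) (c n) w‖ₑ < ⊤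

end

end IrrationalSeries

namespace IrrationalSeries

noncomputable section

/-! Exponentials are grouped into divided differences because the mean value theorem bounds ⟨Δ_S,
e^{tw}⟩ by |w|^N e^{β Re w}, β = min S (`norm_vandermondePackage_le`). Far to the left in H_{a',k'}
this is at most e^{a'β} as soon as N ≤ k'β. So the series has to be rewritten in packages with N ≤
(μ+k)β + c and coefficients of at most exponential growth in β; lowering a' then gives normal
convergence.

Single coefficients A_β are not controlled well enough, but their Riesz means Σ A_β (t-β)_+^n / n!
are. Perron's formula expresses them as an integral of g, and the contour can be moved to a
staircase inside the logarithmic half-plane, where |ζ|^{-(n+1)} compensates e^{t Re ζ} once n ≥ kt +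
2 (`exists_norm_sum_mul_pow_le`). By Taylor's formula a polynomial cutoff χ times a nodal polynomial
of degree p is a superposition of the functions (t-β)_+^p. Hence Σ A_β χ(β) ∏(β-γ) is at most (p+1)!
times an exponential (`exists_norm_sum_cutoff_le`), and the factorial that normalizes Δ_S removes
the factorial growth.

The packages come from Newton interpolation. `cutError` applies the series cut off at m/2 to f minus
its interpolant at about km/2 nodes beyond the cut. From m to m + 1 the cutoff changes only on a
window of length 1; there f may be replaced by its interpolant at the old nodes together with the
exponents of R in the window, whose number is about μm/2. The nodes are then exchanged one at a
time. Each elementary change of nodes is one divided difference times a nodal polynomial, that is,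
one package (`exists_window_packages`).

The partial sums of packages are thus `cutError` of e^{tw}, which agrees with the formal development
up to O(e^{X Re w}). The spare k in k' = (μ+k) + k makes the remaining tail O(e^{X Re w}) too, so g
minus the sum of the packages is flat. A bounded flat holomorphic function on a logarithmic
half-plane vanishes further to the left, by the maximum principle applied after multiplication by
e^{-nw} w^{-kn} (`exists_eqOn_zero_of_flat`). -/

/-! ### Divided differences and changes of interpolation nodes. -/

/-- The divided difference of `f` at the points of `S`. -/
def divDiff (S : Finset ℝ) (f : ℝ → ℂ) : ℂ :=
  ∑ β ∈ S, (vandermondeCoeff S β : ℂ) * f β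

/-- The monic polynomial function with zeros at the points of `V`. -/
def nodal (V : Finset ℝ) (x : ℝ) : ℝ := ∏ γ ∈ V, (x - γ)

/-- The value at `x` of the Lagrange interpolant of `f` at the nodes `V`. -/
def interp (V : Finset ℝ) (f : ℝ → ℂ) (x : ℝ) : ℂ :=
  ∑ γ ∈ V, ((∏ δ ∈ V.erase γ, (x - δ) * (γ - δ)⁻¹ : ℝ) : ℂ) * f γ

theorem interp_of_mem {V : Finset ℝ} {x : ℝ} (hx : x ∈ V) (f : ℝ → ℂ) : interp V f x = f x := by
  unfold interp
  rw [Finset.sum_eq_single x]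
  · rw [Finset.prod_eq_one]
    · simp
    · intro δ hδ
      exact mul_inv_cancel₀ (sub_ne_zero.2 (Finset.ne_of_mem_erase hδ).symm)
  · intro γ _ hne
    rw [Finset.prod_eq_zero (Finset.mem_erase.2 ⟨hne.symm, hx⟩)]
    · simp
    · simp
  · exact fun h => absurd hx h

/-- Newton's form of interpolation. All later packages arise from this identity. -/
theorem interp_sub_interp_erase {W : Finset ℝ} {y : ℝ} (hy : y ∈ W) (f : ℝ → ℂ) (x : ℝ) :
    interp W f x - interp (W.erase y) f x = divDiff W f * nodal (W.erase y) x := by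
  unfold interp divDiff
  rw [← Finset.add_sum_erase _ _ hy, ← Finset.add_sum_erase W
    (fun β => (vandermondeCoeff W β : ℂ) * f β) hy, add_sub_assoc, ← Finset.sum_sub_distrib,
    add_mul, Finset.sum_mul]
  congr 1
  · rw [Finset.prod_mul_distrib, nodal, vandermondeCoeff]
    push_cast
    ring
  · refine Finset.sum_congr rfl fun γ hγ => ?_
    have hγy : γ ≠ y := Finset.ne_of_mem_erase hγ
    have hγW : γ ∈ W := Finset.mem_of_mem_erase hγ
    have hy' : y ∈ W.erase γ := Finset.mem_erase.2 ⟨hγy.symm, hy⟩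
    have key : (∏ δ ∈ W.erase γ, (x - δ) * (γ - δ)⁻¹) -
        ∏ δ ∈ (W.erase y).erase γ, (x - δ) * (γ - δ)⁻¹ =
        vandermondeCoeff W γ * nodal (W.erase y) x := by
      rw [vandermondeCoeff, nodal, ← Finset.mul_prod_erase _ _ hy',
        ← Finset.mul_prod_erase _ (fun δ => (γ - δ)⁻¹) hy', ← Finset.mul_prod_erase _ _ hγ,
        Finset.erase_right_comm (a := γ) (b := y), Finset.prod_mul_distrib]
      have : γ - y ≠ 0 := sub_ne_zero.2 hγy
      field_simp
      ring
    rw [← sub_mul, ← Complex.ofReal_sub, key]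
    push_cast
    ring

/-- The effect on interpolants of a list of elementary changes of the node set: `(W, y, ε)` stands
for inserting (`ε = 1`) the node `y` in `W \ {y}`, or deleting (`ε = -1`) it from `W`. -/
def stepSum (l : List (Finset ℝ × ℝ × ℂ)) (f : ℝ → ℂ) (x : ℝ) : ℂ :=
  (l.map fun q => q.2.2 * (divDiff q.1 f * nodal (q.1.erase q.2.1) x)).sum

theorem stepSum_cons (q : Finset ℝ × ℝ × ℂ) (l : List (Finset ℝ × ℝ × ℂ)) (f : ℝ → ℂ) (x : ℝ) :
    stepSum (q :: l) f x = q.2.2 * (divDiff q.1 f * nodal (q.1.erase q.2.1) x) + stepSum l f x := by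
  simp [stepSum]

/-- Telescoped Newton formula. The set `V ∪ E` is required to occur so that every exponent of `R`
ends up in some package; the lower bound on cardinalities keeps the nodal polynomials of degree at
least `V.card`, the order needed for the Riesz means. -/
theorem exists_insertion_path (V : Finset ℝ) (E : Finset ℝ) (hE : Disjoint V E) :
    ∃ l : List (Finset ℝ × ℝ × ℂ), l.length = E.card ∧
      (∀ q ∈ l, q.2.1 ∈ q.1 ∧ ‖q.2.2‖ ≤ 1 ∧ q.1 ⊆ V ∪ E ∧ V.card + 1 ≤ q.1.card) ∧
      (E.Nonempty → ∃ q ∈ l, q.1 = V ∪ E) ∧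
      ∀ f x, interp (V ∪ E) f x - interp V f x = stepSum l f x := by
  induction E using Finset.induction_on with
  | empty => exact ⟨[], by simp, by simp, by simp, by simp [stepSum]⟩
  | insert y E hy ih =>
    rw [Finset.disjoint_insert_right] at hE
    obtain ⟨l, hl, hq, -, hs⟩ := ih hE.2
    have hyW : y ∉ V ∪ E := by simp [hE.1, hy]
    refine ⟨(V ∪ insert y E, y, 1) :: l, by simp [hl, hy], ?_, fun _ => ⟨_, List.mem_cons_self, rfl⟩, ?_⟩
    · intro q hq'
      rcases List.mem_cons.1 hq' with rfl | h
      · refine ⟨by simp, by simp, subset_rfl, ?_⟩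
        simp only [Finset.union_insert]
        rw [Finset.card_insert_of_notMem hyW]
        have := Finset.card_le_card (Finset.subset_union_left (s₁ := V) (s₂ := E))
        lia
      · obtain ⟨h1, h2, h3, h4⟩ := hq q h
        exact ⟨h1, h2, h3.trans (Finset.union_subset_union_right (Finset.subset_insert _ _)), h4⟩
    · intro f x
      rw [stepSum_cons, ← hs, one_mul, Finset.union_insert,
        ← interp_sub_interp_erase (Finset.mem_insert_self y _), Finset.erase_insert hyW]
      ring

/-- Each new node is inserted before an old one is deleted, so the cardinalities never fall below
`V.card + 1` nor exceed `U.card + 1`. Inserting all of `U` first would make the packages too large.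
-/
theorem exists_exchange_path (U : Finset ℝ) (n : ℕ) : ∀ V : Finset ℝ, (U \ V).card = n →
    V.card ≤ U.card →
    ∃ l : List (Finset ℝ × ℝ × ℂ), l.length ≤ 2 * n ∧
      (∀ q ∈ l, q.2.1 ∈ q.1 ∧ ‖q.2.2‖ ≤ 1 ∧ q.1 ⊆ V ∪ U ∧ V.card + 1 ≤ q.1.card ∧
        q.1.card ≤ U.card + 1) ∧
      (V ≠ U → ∃ q ∈ l, V ⊆ q.1) ∧
      ∀ f x, interp U f x - interp V f x = stepSum l f x := by
  induction n with
  | zero =>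
    intro V hV hcard
    have hUV : U = V := Finset.eq_of_subset_of_card_le
      (Finset.sdiff_eq_empty_iff_subset.1 (Finset.card_eq_zero.1 hV)) hcard
    exact ⟨[], by simp, by simp, fun h => absurd hUV.symm h, by simp [stepSum, hUV]⟩
  | succ n ih =>
    intro V hV hcard
    obtain ⟨x, hx⟩ : (U \ V).Nonempty := Finset.card_pos.1 (by lia)
    have hxU : x ∈ U := (Finset.mem_sdiff.1 hx).1
    have hxV : x ∉ V := (Finset.mem_sdiff.1 hx).2
    have hcx : (insert x V).card = V.card + 1 := Finset.card_insert_of_notMem hxV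
    by_cases hsub : V ⊆ U
    · have hsd : U \ insert x V = (U \ V).erase x := by
        ext z; simp; tauto
      obtain ⟨l, hl, hq, -, hs⟩ := ih (insert x V)
        (by rw [hsd, Finset.card_erase_of_mem hx, hV]; rfl)
        (Finset.card_le_card (Finset.insert_subset hxU hsub))
      refine ⟨(insert x V, x, 1) :: l, by simp; lia, ?_, fun _ => ⟨_, List.mem_cons_self,
        Finset.subset_insert _ _⟩, ?_⟩
      · intro q hq'
        rcases List.mem_cons.1 hq' with rfl | h
        · refine ⟨by simp, by simp, Finset.insert_subset (by simp [hxU])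
            Finset.subset_union_left, hcx.ge, ?_⟩
          simp only [hcx]
          lia
        · obtain ⟨h1, h2, h3, h4, h5⟩ := hq q h
          refine ⟨h1, h2, h3.trans ?_, by lia, h5⟩
          exact Finset.union_subset (Finset.insert_subset (by simp [hxU])
            Finset.subset_union_left) Finset.subset_union_right
      · intro f z
        rw [stepSum_cons, ← hs, one_mul,
          ← interp_sub_interp_erase (Finset.mem_insert_self x _), Finset.erase_insert hxV]
        ring
    · obtain ⟨y, hyV, hyU⟩ := Finset.not_subset.1 hsub
      have hyW : y ∈ insert x V := Finset.mem_insert_of_mem hyV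
      have hsd : U \ (insert x V).erase y = (U \ V).erase x := by
        ext z
        simp only [Finset.mem_sdiff, Finset.mem_erase, Finset.mem_insert, not_and, not_or]
        constructor
        · rintro ⟨h1, h2⟩
          have h3 := h2 (fun h => hyU (h ▸ h1))
          exact ⟨h3.1, h1, h3.2⟩
        · rintro ⟨h1, h2, h3⟩
          exact ⟨h2, fun _ => ⟨h1, h3⟩⟩
      have hc' : ((insert x V).erase y).card = V.card := by
        rw [Finset.card_erase_of_mem hyW, hcx]; rfl
      obtain ⟨l, hl, hq, -, hs⟩ := ih ((insert x V).erase y)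
        (by rw [hsd, Finset.card_erase_of_mem hx, hV]; rfl) (by rw [hc']; exact hcard)
      have hW : insert x V ⊆ V ∪ U :=
        Finset.insert_subset (by simp [hxU]) Finset.subset_union_left
      refine ⟨(insert x V, x, 1) :: (insert x V, y, -1) :: l, by simp; lia, ?_,
        fun _ => ⟨_, List.mem_cons_self, Finset.subset_insert _ _⟩, ?_⟩
      · intro q hq'
        rcases List.mem_cons.1 hq' with rfl | h
        · exact ⟨by simp, by simp, hW, hcx.ge, by simp only [hcx]; lia⟩
        rcases List.mem_cons.1 h with rfl | h
        · exact ⟨hyW, by simp, hW, hcx.ge, by simp only [hcx]; lia⟩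
        · obtain ⟨h1, h2, h3, h4, h5⟩ := hq q h
          refine ⟨h1, h2, h3.trans ?_, by lia, h5⟩
          exact Finset.union_subset ((Finset.erase_subset _ _).trans hW) Finset.subset_union_right
      · intro f z
        rw [stepSum_cons, stepSum_cons, ← hs, one_mul,
          ← interp_sub_interp_erase (Finset.mem_insert_self x _), Finset.erase_insert hxV,
          ← interp_sub_interp_erase hyW]
        ring

/-! ### Taylor's formula with truncated powers, and step polynomials. -/

open Polynomial in
theorem eval_iterate_derivative_eq_zero {Q : ℂ[X]} {b : ℂ} {n : ℕ} (h : (X - C b) ^ n ∣ Q) {j : ℕ}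
    (hj : j < n) : (derivative^[j] Q).eval b = 0 := by
  have h1 : (X - C b) ^ (n - j) ∣ derivative^[j] Q := Polynomial.pow_sub_dvd_iterate_derivative_of_pow_dvd j h
  have h2 : (X - C b) ∣ derivative^[j] Q := (dvd_pow_self _ (by lia)).trans h1
  exact Polynomial.dvd_iff_isRoot.1 h2

open Polynomial in
/-- Taylor's formula with integral remainder at a zero of high order of a polynomial. -/
theorem integral_pow_mul_iterate_derivative (Q : ℂ[X]) (β b : ℝ) (n : ℕ)
    (h : (X - C (b : ℂ)) ^ n ∣ Q) (p : ℕ) (hp : p < n) :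
    ∫ t in β..b, (((t - β) ^ p / p.factorial : ℝ) : ℂ) * (derivative^[p + 1] Q).eval (t : ℂ) =
      (-1) ^ (p + 1) * Q.eval (β : ℂ) := by
  have hd : ∀ (S : ℂ[X]) (t : ℝ), HasDerivAt (fun t : ℝ => S.eval (t : ℂ)) ((derivative S).eval (t : ℂ)) t :=
    fun S t => (S.hasDerivAt (t : ℂ)).comp_ofReal
  have hc : ∀ S : ℂ[X], Continuous fun t : ℝ => S.eval (t : ℂ) := fun S =>
    S.continuous.comp Complex.continuous_ofReal
  induction p with
  | zero =>
    have h0 : Q.eval (b : ℂ) = 0 := by simpa using eval_iterate_derivative_eq_zero h hp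
    have := intervalIntegral.integral_eq_sub_of_hasDerivAt (a := β) (b := b)
      (fun t _ => hd Q t) ((hc _).intervalIntegrable _ _)
    simp [this, h0]
  | succ p ih =>
    have hu : ∀ t : ℝ, HasDerivAt (fun t : ℝ => (((t - β) ^ (p + 1) / (p + 1).factorial : ℝ) : ℂ))
        (((t - β) ^ p / p.factorial : ℝ) : ℂ) t := by
      intro t
      have h1 : HasDerivAt (fun t : ℝ => (t - β) ^ (p + 1) / (p + 1).factorial)
          ((t - β) ^ p / p.factorial) t := by
        have h2 := (((hasDerivAt_id t).sub_const β).pow (p + 1)).div_const ((p + 1).factorial : ℝ)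
        convert! h2 using 1
        rw [Nat.factorial_succ]
        have : (p.factorial : ℝ) ≠ 0 := by positivity
        push_cast
        field_simp
        simp
      exact h1.ofReal_comp
    have hcu : ∀ m : ℕ, Continuous fun t : ℝ => (((t - β) ^ m / m.factorial : ℝ) : ℂ) := fun m => by
      fun_prop
    -- In this integration by parts the boundary term at `β` vanishes through the power of `t - β`,
    -- the one at `b` through the zero of order `n > p`.
    have key := intervalIntegral.integral_mul_deriv_eq_deriv_mul (a := β) (b := b)
      (fun t _ => hu t) (fun t _ => hd (derivative^[p + 1] Q) t)
      ((hcu p).intervalIntegrable _ _) ((hc _).intervalIntegrable _ _)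
    rw [Function.iterate_succ_apply', key, ih (by lia),
      eval_iterate_derivative_eq_zero h hp]
    simp
    ring

open Polynomial in
/-- Taylor's formula for a polynomial that vanishes to high order at `b` and agrees to high order
with a polynomial of low degree at `a`. -/
theorem integral_posPart_pow_mul_iterate_derivative (Q w : ℂ[X]) (β a b : ℝ) (hab : a ≤ b) (n : ℕ)
    (hb : (X - C (b : ℂ)) ^ n ∣ Q) (ha : (X - C (a : ℂ)) ^ n ∣ Q - w) (p : ℕ) (hp : p < n)
    (hp0 : p ≠ 0) (hw : w.natDegree < p + 1) :
    ∫ t in a..b, (((max (t - β) 0) ^ p / p.factorial : ℝ) : ℂ) *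
        (derivative^[p + 1] Q).eval (t : ℂ) =
      (-1) ^ (p + 1) * (if β ≤ a then w.eval (β : ℂ) else if β ≤ b then Q.eval (β : ℂ) else 0) := by
  have hc : ∀ S : ℂ[X], Continuous fun t : ℝ => S.eval (t : ℂ) := fun S =>
    S.continuous.comp Complex.continuous_ofReal
  set F : ℝ → ℂ := fun t => (((max (t - β) 0) ^ p / p.factorial : ℝ) : ℂ) *
        (derivative^[p + 1] Q).eval (t : ℂ) with hF
  have hFc : Continuous F := by
    have := hc (derivative^[p + 1] Q)
    simp only [hF]
    fun_prop
  have pos : ∀ c, β ≤ c → ∫ t in β..c, F t = ∫ t in β..c, (((t - β) ^ p / p.factorial : ℝ) : ℂ) *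
        (derivative^[p + 1] Q).eval (t : ℂ) := by
    intro c hc
    refine intervalIntegral.integral_congr fun t ht => ?_
    rw [uIcc_of_le hc] at ht
    simp only [hF, max_eq_left (sub_nonneg.2 ht.1)]
  have neg : ∀ c d, c ≤ d → d ≤ β → ∫ t in c..d, F t = 0 := by
    intro c d hcd hd
    rw [intervalIntegral.integral_congr (g := fun _ => 0)]
    · simp
    · intro t ht
      rw [uIcc_of_le hcd] at ht
      simp [hF, max_eq_right (sub_nonpos.2 (ht.2.trans hd)), hp0]
  split_ifs with h1 h2
  -- The integral over `[a, b]` is the one over `[β, b]` minus the one over `[β, a]`. On the latter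
  -- `Q` may be replaced by `Q - w`, which vanishes to high order at `a`, so that the difference
  -- leaves `w.eval β`.
  · have hder : derivative^[p + 1] Q = derivative^[p + 1] (Q - w) := by
      rw [iterate_derivative_sub, iterate_derivative_eq_zero hw, sub_zero]
    rw [← intervalIntegral.integral_interval_sub_left (hFc.intervalIntegrable β b)
      (hFc.intervalIntegrable β a), pos _ (h1.trans hab), pos _ h1,
      integral_pow_mul_iterate_derivative Q β b n hb p hp, hder,
      integral_pow_mul_iterate_derivative (Q - w) β a n ha p hp, eval_sub]
    ring
  · push Not at h1
    rw [← intervalIntegral.integral_add_adjacent_intervals (hFc.intervalIntegrable a β)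
      (hFc.intervalIntegrable β b), neg _ _ h1.le le_rfl, pos _ h2,
      integral_pow_mul_iterate_derivative Q β b n hb p hp, zero_add]
  · push Not at h2
    simp [neg _ _ hab h2.le]

open Polynomial in
/-- Cauchy's estimate for the derivatives of a polynomial. -/
theorem norm_eval_iterate_derivative_le (Q : ℂ[X]) (z : ℂ) (p : ℕ) (M : ℝ)
    (hM : ∀ ζ, ‖ζ - z‖ = 1 → ‖Q.eval ζ‖ ≤ M) :
    ‖(derivative^[p] Q).eval z‖ ≤ p.factorial * M := by
  have h := Complex.norm_iteratedDeriv_le_of_forall_mem_sphere_norm_le (c := z) (R := 1) (C := M)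
    (f := fun ζ => Q.eval ζ) p one_pos (Q.differentiable.diffContOnCl) (by
      intro ζ hζ
      exact hM ζ (by simpa [dist_eq_norm] using hζ))
  have h2 : ∀ p, iteratedDeriv p (fun ζ => Q.eval ζ) = fun ζ => (derivative^[p] Q).eval ζ := by
    intro p
    induction p with
    | zero => simp
    | succ p ih =>
      rw [iteratedDeriv_succ, ih]
      ext ζ
      rw [Polynomial.deriv, Function.iterate_succ_apply']
  rw [h2] at h
  simpa using h

open Polynomial in
/-- The polynomial of degree `2n - 1` with value `1` to order `n` at `0` and `0` to order `n`
at `1`. -/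
def stepPoly (n : ℕ) : ℂ[X] :=
  ∑ j ∈ Finset.range n, ((2 * n - 1).choose j : ℂ[X]) * (X ^ j * (1 - X) ^ (2 * n - 1 - j))

open Polynomial in
theorem one_sub_X_pow_dvd_stepPoly (n : ℕ) : (1 - X) ^ n ∣ stepPoly n := by
  refine Finset.dvd_sum fun j hj => ?_
  have := Finset.mem_range.1 hj
  exact ((pow_dvd_pow _ (by lia)).mul_left _).mul_left _

-- `stepPoly n` is the first half of the binomial expansion of (X + (1 - X))^(2n-1) = 1; all terms
-- of the second half contain X^n.
open Polynomial in
theorem X_pow_dvd_stepPoly_sub_one (n : ℕ) (hn : 1 ≤ n) : X ^ n ∣ stepPoly n - 1 := by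
  have h : (1 : ℂ[X]) = ∑ j ∈ Finset.range (2 * n),
      ((2 * n - 1).choose j : ℂ[X]) * (X ^ j * (1 - X) ^ (2 * n - 1 - j)) := by
    have := add_pow (X : ℂ[X]) (1 - X) (2 * n - 1)
    rw [add_sub_cancel, one_pow, show 2 * n - 1 + 1 = 2 * n by lia] at this
    exact this.trans (Finset.sum_congr rfl fun j _ => mul_comm _ _)
  rw [h, stepPoly, show 2 * n = n + n by lia, Finset.sum_range_add, ← sub_sub, sub_self, zero_sub,
    dvd_neg]
  exact Finset.dvd_sum fun j _ => ((pow_dvd_pow _ (by lia)).mul_right _).mul_left _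

open Polynomial in
theorem norm_eval_stepPoly_le (n : ℕ) (z : ℂ) :
    ‖(stepPoly n).eval z‖ ≤ (‖z‖ + ‖1 - z‖) ^ (2 * n) + 1 := by
  rcases Nat.eq_zero_or_pos n with rfl | hn
  · simp [stepPoly]
  have h1 : ‖(stepPoly n).eval z‖ ≤ (‖z‖ + ‖1 - z‖) ^ (2 * n - 1) := by
    rw [stepPoly, eval_finsetSum, add_pow]
    refine (norm_sum_le _ _).trans ?_
    refine (Finset.sum_le_sum_of_subset_of_nonneg (Finset.range_subset_range.2 (by lia : n ≤ 2 * n - 1 + 1))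
      fun _ _ _ => norm_nonneg _).trans ?_
    refine Finset.sum_le_sum fun j _ => ?_
    simp only [eval_mul, eval_natCast, eval_pow, eval_X, eval_sub, eval_one, norm_mul, norm_pow,
      Complex.norm_natCast]
    exact (mul_comm _ _).le
  have h2 : 1 ≤ ‖z‖ + ‖1 - z‖ := by
    have := norm_add_le z (1 - z)
    simpa using this
  have h3 := pow_le_pow_right₀ h2 (show 2 * n - 1 ≤ 2 * n by lia)
  linarith

/-! ### The mean value theorem and the basic bound for Vandermonde packages. -/

/-- Iterated Rolle theorem. -/
theorem exists_zero_of_hasDerivAt_iterate (n : ℕ) : ∀ (F : ℕ → ℝ → ℝ)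
    (_ : ∀ j t, HasDerivAt (F j) (F (j + 1) t) t) (z : Fin (n + 1) → ℝ) (_ : StrictMono z)
    (_ : ∀ i, F 0 (z i) = 0), ∃ ξ, z 0 ≤ ξ ∧ F n ξ = 0 := by
  induction n with
  | zero => exact fun F _ z _ h => ⟨z 0, le_rfl, h 0⟩
  | succ n ih =>
    intro F hF z hz h0
    have h : ∀ i : Fin (n + 1), ∃ c ∈ Ioo (z i.castSucc) (z i.succ), F 1 c = 0 := fun i =>
      exists_hasDerivAt_eq_zero (hz Fin.castSucc_lt_succ)
        (fun t _ => (hF 0 t).continuousAt.continuousWithinAt) (by rw [h0, h0]) (fun t _ => hF 0 t)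
    choose c hc hc0 using h
    obtain ⟨ξ, h1, h2⟩ := ih (fun j => F (j + 1)) (fun j => hF (j + 1)) c
      (Fin.strictMono_iff_lt_succ.2 fun i => by
        have h1 := (hc i.castSucc).2
        have h2 := (hc i.succ).1
        rw [Fin.succ_castSucc] at h1
        exact h1.trans h2) hc0
    refine ⟨ξ, le_trans (le_of_lt ?_) h1, h2⟩
    exact (hc 0).1

open Polynomial in
/-- Mean value theorem for divided differences. -/
theorem exists_divDiff_eq (S : Finset ℝ) (n : ℕ) (hS : S.card = n + 1) (β : ℝ)
    (hβ : IsLeast (S : Set ℝ) β) (F : ℕ → ℝ → ℝ)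
    (hF : ∀ j t, HasDerivAt (F j) (F (j + 1) t) t) :
    ∃ ξ, β ≤ ξ ∧ n.factorial * ∑ γ ∈ S, vandermondeCoeff S γ * F 0 γ = F n ξ := by
  set p : ℝ[X] := Lagrange.interpolate S id (F 0) with hp
  have hdeg : p.degree < S.card := Lagrange.degree_interpolate_lt _ (injOn_id _)
  have hev : ∀ γ ∈ S, p.eval γ = F 0 γ := fun γ hγ =>
    Lagrange.eval_interpolate_at_node (r := F 0) (v := id) (injOn_id _) hγ
  have hcoeff : ∑ γ ∈ S, vandermondeCoeff S γ * F 0 γ = p.coeff n := by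
    rw [← sum_eval_mul_vandermondeCoeff S n hS p hdeg]
    exact Finset.sum_congr rfl fun γ hγ => by rw [hev γ hγ, mul_comm]
  have hpn : ∀ t, (derivative^[n] p).eval t = n.factorial * p.coeff n := by
    intro t
    have h1 : (derivative^[n] p).natDegree = 0 := by
      have := natDegree_iterate_derivative p n
      have h2 : p.natDegree ≤ n := by
        rw [hS] at hdeg
        exact natDegree_le_iff_degree_le.2 (Order.lt_succ_iff.1 hdeg)
      lia
    rw [eq_C_of_natDegree_eq_zero h1, eval_C, coeff_iterate_derivative]
    simp [Nat.descFactorial_self]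
  -- Rolle is applied to `F 0` minus its interpolant, which has `n + 1` zeros; the `n`-th derivative
  -- of the interpolant is constant, `n!` times its leading coefficient.
  obtain ⟨ξ, h1, h2⟩ := exists_zero_of_hasDerivAt_iterate n
    (fun j t => F j t - (derivative^[j] p).eval t)
    (fun j t => by
      have := (derivative^[j] p).hasDerivAt t
      rw [← Function.iterate_succ_apply' (f := derivative)] at this
      exact (hF j t).sub this)
    (S.orderEmbOfFin hS) (S.orderEmbOfFin hS).strictMono
    (fun i => by
      have := hev _ (S.orderEmbOfFin_mem hS i)
      simp [this])
  refine ⟨ξ, (hβ.2 (S.orderEmbOfFin_mem hS 0)).trans h1, ?_⟩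
  rw [hcoeff, ← hpn ξ]
  linarith

theorem vandermondePackage_eq (S : Finset ℝ) (n : ℕ) (hS : S.card = n + 1) (w : ℂ) :
    vandermondePackage S w = n.factorial * divDiff S fun t => Complex.exp (t * w) := by
  simp only [vandermondePackage, package, normalizedVandermondeCoeff, divDiff, hS,
    Nat.add_sub_cancel, Finset.mul_sum]
  exact Finset.sum_congr rfl fun β _ => by push_cast; ring

/-- The `n`-th derivative of e^{tw} in `t` is w^n e^{tw}, and for Re w ≤ 0 its modulus at ξ ≥ β is
largest at β; only a lower bound for the mean value point is therefore needed. -/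
theorem norm_vandermondePackage_le (S : Finset ℝ) (n : ℕ) (hS : S.card = n + 1) (β : ℝ)
    (hβ : IsLeast (S : Set ℝ) β) (w : ℂ) (hw : w.re ≤ 0) :
    ‖vandermondePackage S w‖ ≤ ‖w‖ ^ n * Real.exp (β * w.re) := by
  set v := vandermondePackage S w with hv
  rcases eq_or_ne v 0 with h0 | h0
  · rw [h0, norm_zero]; positivity
  -- The mean value theorem fails for complex values: a unimodular factor makes the package equal to
  -- its modulus, and the real part is then treated.
  set c : ℂ := (starRingEnd ℂ v) / ‖v‖ with hc
  have hn0 : (‖v‖ : ℂ) ≠ 0 := by simpa using h0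
  have hcv : c * v = ‖v‖ := by
    rw [hc, div_mul_eq_mul_div, Complex.conj_mul', div_eq_iff hn0, sq]
  have hcn : ‖c‖ = 1 := by
    rw [hc, norm_div, RCLike.norm_conj, Complex.norm_real, norm_norm, div_self (by simpa using h0)]
  have hexp : ∀ t : ℝ, HasDerivAt (fun t : ℝ => Complex.exp (t * w)) (w * Complex.exp (t * w)) t := by
    intro t
    have h1 : HasDerivAt (fun z : ℂ => Complex.exp (z * w)) (Complex.exp (t * w) * (1 * w)) t :=
      ((hasDerivAt_id (t : ℂ)).mul_const w).cexp
    convert! h1.comp_ofReal using 1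
    ring
  obtain ⟨ξ, h1, h2⟩ := exists_divDiff_eq S n hS β hβ
    (fun j t => (c * (w ^ j * Complex.exp (t * w))).re) (fun j t => by
      have h3 := ((hexp t).const_mul (w ^ j)).const_mul c
      have h4 := (Complex.reCLM.hasFDerivAt.comp_hasDerivAt t h3)
      convert! h4 using 1
      simp only [Complex.reCLM_apply]
      ring_nf)
  have h3 : ‖v‖ = (c * (w ^ n * Complex.exp (ξ * w))).re := by
    rw [← h2, ← Complex.ofReal_re ‖v‖, ← hcv, hv, vandermondePackage_eq S n hS, divDiff]
    have : c * (n.factorial * ∑ γ ∈ S, (vandermondeCoeff S γ : ℂ) * Complex.exp (γ * w)) =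
        (n.factorial : ℝ) * ∑ γ ∈ S, (vandermondeCoeff S γ : ℂ) * (c * (w ^ 0 * Complex.exp (γ * w))) := by
      rw [mul_left_comm, Finset.mul_sum]
      push_cast
      congr 1
      exact Finset.sum_congr rfl fun γ _ => by ring
    rw [this, Complex.re_ofReal_mul, Complex.re_sum]
    simp only [Complex.re_ofReal_mul]
  rw [h3]
  refine (Complex.re_le_norm _).trans ?_
  rw [norm_mul, hcn, one_mul, norm_mul, norm_pow, Complex.norm_exp, Complex.re_ofReal_mul]
  gcongr 2
  exact mul_le_mul_of_nonpos_right h1 hw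

/-! ### The Laplace transform of powers and Perron's formula. -/

open MeasureTheory

theorem integrableOn_pow_mul_cexp (n : ℕ) (z : ℂ) (hz : 0 < z.re) :
    IntegrableOn (fun τ : ℝ => (τ : ℂ) ^ n * Complex.exp (-(z * τ))) (Ioi 0) := by
  have h := (Real.GammaIntegral_convergent (s := n + 1) (by positivity))
  have h2 : IntegrableOn (fun τ : ℝ => Real.exp (-(z.re * τ)) * (z.re * τ) ^ ((n : ℝ) + 1 - 1)) (Ioi 0) := by
    have := (integrableOn_Ioi_comp_mul_left_iff (fun x => Real.exp (-x) * x ^ ((n : ℝ) + 1 - 1)) 0 hz).2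
      (by simpa using h)
    simpa using this
  have h3 := h2.norm.const_mul ((z.re ^ n)⁻¹)
  refine h3.mono (by fun_prop) ?_
  refine (ae_restrict_iff' measurableSet_Ioi).2 (ae_of_all _ fun τ hτ => ?_)
  have hτ' : 0 < τ := hτ
  have h4 : z.re * τ ≠ 0 := by positivity
  rw [norm_mul, norm_pow, Complex.norm_exp, Complex.norm_real]
  simp only [add_sub_cancel_right, Real.rpow_natCast, Complex.neg_re, Complex.mul_re,
    Complex.ofReal_re, Complex.ofReal_im, mul_zero, sub_zero, norm_mul, norm_inv,
    norm_pow, Real.norm_eq_abs, abs_of_pos hτ', abs_of_pos hz, Real.abs_exp]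
  apply le_of_eq
  rw [mul_pow]
  field_simp

theorem integral_pow_mul_cexp (n : ℕ) (z : ℂ) (hz : 0 < z.re) :
    ∫ τ in Ioi (0 : ℝ), (τ : ℂ) ^ n * Complex.exp (-(z * τ)) = n.factorial / z ^ (n + 1) := by
  have hz0 : z ≠ 0 := fun h => by simp [h] at hz
  have hlim : ∀ n : ℕ, Tendsto (fun τ : ℝ => (τ : ℂ) ^ n * Complex.exp (-(z * τ))) atTop (𝓝 0) := by
    intro n
    rw [tendsto_zero_iff_norm_tendsto_zero]
    have h1 := (Real.tendsto_pow_mul_exp_neg_atTop_nhds_zero n).comp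
      (tendsto_id.const_mul_atTop hz)
    have h2 := h1.const_mul ((z.re ^ n)⁻¹)
    rw [mul_zero] at h2
    refine h2.congr' ?_
    filter_upwards [eventually_gt_atTop 0] with τ hτ
    rw [norm_mul, norm_pow, Complex.norm_exp, Complex.norm_real]
    simp only [Function.comp, id, Complex.neg_re, Complex.mul_re,
      Complex.ofReal_re, Complex.ofReal_im, mul_zero, sub_zero, Real.norm_eq_abs, abs_of_pos hτ]
    rw [mul_pow]
    field_simp
  have hexp : ∀ τ : ℝ, HasDerivAt (fun τ : ℝ => Complex.exp (-(z * τ)))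
      (-z * Complex.exp (-(z * τ))) τ := by
    intro τ
    have h1 : HasDerivAt (fun s : ℂ => Complex.exp (-(z * s))) (Complex.exp (-(z * τ)) * -(z * 1)) τ :=
      (((hasDerivAt_id (τ : ℂ)).const_mul z).neg).cexp
    convert! h1.comp_ofReal using 1
    ring
  induction n with
  | zero =>
    have h := integral_Ioi_of_hasDerivAt_of_tendsto (a := 0) (m := 0)
      (f := fun τ : ℝ => -z⁻¹ * Complex.exp (-(z * τ)))
      (f' := fun τ : ℝ => (τ : ℂ) ^ 0 * Complex.exp (-(z * τ)))
      (by fun_prop) (fun τ _ => by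
        convert! (hexp τ).const_mul (-z⁻¹) using 1
        field_simp) (integrableOn_pow_mul_cexp 0 z hz)
        (by simpa using (hlim 0).const_mul (-z⁻¹))
    rw [h]
    simp
  | succ n ih =>
    have hI := (integrableOn_pow_mul_cexp n z hz).const_mul ((n : ℂ) + 1)
    have hI' := (integrableOn_pow_mul_cexp (n + 1) z hz).const_mul z
    have h := integral_Ioi_of_hasDerivAt_of_tendsto (a := 0) (m := 0)
      (f := fun τ : ℝ => (τ : ℂ) ^ (n + 1) * Complex.exp (-(z * τ)))
      (f' := fun τ : ℝ => ((n : ℂ) + 1) * ((τ : ℂ) ^ n * Complex.exp (-(z * τ))) -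
        z * ((τ : ℂ) ^ (n + 1) * Complex.exp (-(z * τ))))
      (by fun_prop) (fun τ _ => by
        have h1 : HasDerivAt (fun τ : ℝ => (τ : ℂ) ^ (n + 1)) (((n + 1 : ℕ) : ℂ) * (τ : ℂ) ^ n) τ := by
          simpa using (hasDerivAt_pow (n + 1) (τ : ℂ)).comp_ofReal
        convert! h1.mul (hexp τ) using 1
        push_cast
        ring) (hI.sub hI') (hlim _)
    rw [integral_sub hI hI', integral_const_mul, integral_const_mul, ih] at h
    have h3 : z * ∫ τ in Ioi (0 : ℝ), (τ : ℂ) ^ (n + 1) * Complex.exp (-(z * τ)) =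
        ((n : ℂ) + 1) * (n.factorial / z ^ (n + 1)) := by
      have h4 : (((0 : ℝ) : ℂ)) ^ (n + 1) = 0 := by simp
      rw [h4, zero_mul, sub_zero] at h
      linear_combination -h
    rw [← mul_right_inj' hz0, h3, Nat.factorial_succ]
    push_cast
    field_simp
    ring

theorem norm_ge_of_re_im (σ y : ℝ) : σ ^ 2 + y ^ 2 = ‖(σ + y * Complex.I : ℂ)‖ ^ 2 := by
  rw [Complex.sq_norm, Complex.normSq_add_mul_I]

theorem integrable_inv_pow (σ : ℝ) (hσ : 0 < σ) (n : ℕ) (hn : 1 ≤ n) :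
    Integrable fun y : ℝ => ((σ + y * Complex.I : ℂ) ^ (n + 1))⁻¹ := by
  have h1 : Integrable fun y : ℝ => (σ ^ (n + 1))⁻¹ * (1 + (σ⁻¹ * y) ^ 2)⁻¹ :=
    (integrable_inv_one_add_sq.comp_mul_left' (inv_ne_zero hσ.ne')).const_mul _
  have hne : ∀ y : ℝ, (σ + y * Complex.I : ℂ) ≠ 0 := fun y h => by
    have := congrArg Complex.re h
    simp at this
    exact hσ.ne' this
  refine h1.mono ?_ (ae_of_all _ fun y => ?_)
  · refine Continuous.aestronglyMeasurable ?_
    exact Continuous.inv₀ (by fun_prop) fun y => pow_ne_zero _ (hne y)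
  · have h2 : σ ≤ ‖(σ + y * Complex.I : ℂ)‖ := by
      simpa using (Complex.re_le_norm (σ + y * Complex.I : ℂ))
    rw [norm_inv, norm_pow, norm_mul, norm_inv, norm_inv, norm_pow, Real.norm_of_nonneg hσ.le,
      Real.norm_of_nonneg (by positivity : 0 ≤ 1 + (σ⁻¹ * y) ^ 2), ← mul_inv]
    refine inv_anti₀ (by positivity) ?_
    have h3 : σ ^ (n + 1) * (1 + (σ⁻¹ * y) ^ 2) = σ ^ (n - 1) * (σ ^ 2 + y ^ 2) := by
      obtain ⟨m, rfl⟩ := Nat.exists_eq_add_of_le' hn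
      rw [show m + 1 - 1 = m by lia]
      field_simp
      ring
    rw [h3, norm_ge_of_re_im, show n + 1 = (n - 1) + 2 by lia, pow_add _ (n - 1) 2]
    gcongr

open FourierTransform in
/-- Perron's formula. -/
theorem integral_cexp_div_pow (σ : ℝ) (hσ : 0 < σ) (n : ℕ) (hn : 1 ≤ n) (u : ℝ) :
    ∫ y : ℝ, Complex.exp (u * (σ + y * Complex.I)) * ((σ + y * Complex.I : ℂ) ^ (n + 1))⁻¹ =
      2 * Real.pi * ((max u 0 ^ n / n.factorial : ℝ) : ℂ) := by
  -- The Fourier transform of the damped power τ_+^n e^{-στ} is a Laplace integral, equal to n!/(σ +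
  -- 2πiξ)^{n+1}; Perron's formula is Fourier inversion for it. The condition `1 ≤ n` makes `f`
  -- continuous and its transform integrable.
  set f : ℝ → ℂ := fun τ => ((max τ 0 ^ n * Real.exp (-(σ * τ)) : ℝ) : ℂ) with hf
  have hcont : Continuous f := by
    simp only [hf]; fun_prop
  have hn0 : n ≠ 0 := by lia
  have hind : ∀ z : ℂ, (fun τ : ℝ => Complex.exp (-(z * τ)) * f τ) =
      (Ioi (0 : ℝ)).indicator (fun τ : ℝ => (τ : ℂ) ^ n * Complex.exp (-((σ + z) * τ))) := by
    intro z
    ext τ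
    by_cases h : τ ∈ Ioi (0 : ℝ)
    · rw [indicator_of_mem h]
      have h' : 0 < τ := h
      simp only [hf, max_eq_left h'.le]
      push_cast
      rw [mul_left_comm, ← Complex.exp_add]
      ring_nf
    · rw [indicator_of_notMem h]
      have h' : τ ≤ 0 := not_lt.1 h
      simp [hf, max_eq_right h', hn0]
  have hint : Integrable f := by
    have h1 := hind 0
    simp only [zero_mul, neg_zero, Complex.exp_zero, one_mul, add_zero] at h1
    rw [show f = _ from h1, integrable_indicator_iff measurableSet_Ioi]
    exact integrableOn_pow_mul_cexp n σ (by simpa using hσ)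
  have hF : 𝓕 f = fun ξ : ℝ => n.factorial * ((σ + (2 * Real.pi * ξ : ℝ) * Complex.I : ℂ) ^ (n + 1))⁻¹ := by
    ext ξ
    rw [Real.fourier_eq']
    have h1 : (fun v : ℝ => Complex.exp (((-2 * Real.pi * inner ℝ v ξ : ℝ) : ℂ) * Complex.I) • f v) =
        (Ioi (0 : ℝ)).indicator (fun τ : ℝ => (τ : ℂ) ^ n *
          Complex.exp (-((σ + (2 * Real.pi * ξ : ℝ) * Complex.I) * τ))) := by
      rw [← hind]
      ext τ
      simp only [smul_eq_mul]
      congr 2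
      simp
      ring
    rw [h1, integral_indicator measurableSet_Ioi, integral_pow_mul_cexp _ _ (by simpa using hσ)]
    rfl
  have hpi : (2 * Real.pi) ≠ 0 := by positivity
  have hFint : Integrable (𝓕 f) := by
    rw [hF]
    exact ((integrable_inv_pow σ hσ n hn).comp_mul_left' hpi).const_mul _
  have hinv := congrFun (hcont.fourierInv_fourier_eq hint hFint) u
  rw [Real.fourierInv_eq', hF] at hinv
  set K : ℝ → ℂ := fun y : ℝ => (n.factorial : ℂ) * Complex.exp (-(u * σ)) *
        (Complex.exp (u * (σ + y * Complex.I)) * ((σ + y * Complex.I : ℂ) ^ (n + 1))⁻¹) with hK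
  have h2 : ∫ v : ℝ, Complex.exp (((2 * Real.pi * inner ℝ v u : ℝ) : ℂ) * Complex.I) •
      ((n.factorial : ℂ) * ((σ + (2 * Real.pi * v : ℝ) * Complex.I : ℂ) ^ (n + 1))⁻¹) =
      ∫ v : ℝ, K (2 * Real.pi * v) := by
    congr 1
    ext v
    have : Complex.exp (((2 * Real.pi * inner ℝ v u : ℝ) : ℂ) * Complex.I) = Complex.exp (-(u * σ)) *
      Complex.exp (u * (σ + (2 * Real.pi * v : ℝ) * Complex.I)) := by
      rw [← Complex.exp_add]
      congr 1
      simp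
      ring
    rw [this, smul_eq_mul]
    simp only [hK]
    ring
  rw [h2, Measure.integral_comp_mul_left K, hK, integral_const_mul, abs_of_pos (by positivity)] at hinv
  simp only [hf] at hinv
  have hfac : (n.factorial : ℂ) ≠ 0 := by exact_mod_cast n.factorial_ne_zero
  have hexp : Complex.exp (-(u * σ)) ≠ 0 := Complex.exp_ne_zero _
  have hpi' : (Real.pi : ℂ) ≠ 0 := by exact_mod_cast Real.pi_ne_zero
  have hexp' : ((Real.exp (-(σ * u)) : ℝ) : ℂ) = Complex.exp (-(u * σ)) := by
    push_cast
    ring_nf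
  rw [Complex.real_smul, Complex.ofReal_mul, hexp'] at hinv
  generalize (∫ y : ℝ, Complex.exp (u * (σ + y * Complex.I)) *
      ((σ + y * Complex.I : ℂ) ^ (n + 1))⁻¹) = J at hinv ⊢
  refine mul_left_cancel₀ hexp ?_
  push_cast at hinv ⊢
  field_simp at hinv ⊢
  linear_combination hinv

/-! ### Riesz means: contours in a logarithmic half-plane. -/

theorem IsExponentSet.finite_inter_Iio {R : Set ℝ} (hR : IsExponentSet R) (x : ℝ) :
    (R ∩ Iio x).Finite := by
  have h := Metric.finite_isBounded_inter_isClosed (K := Icc 0 x) hR.isDiscrete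
    (Metric.isBounded_Icc 0 x) hR.isClosed
  exact h.subset fun y hy => ⟨⟨hR.nonneg hy.1, hy.2.le⟩, hy.1⟩

/-- The boundary curve allows |y| to grow like e^{x/k}: each step of width `k` to the left
multiplies the admissible height by `e`. -/
theorem exists_staircase (a k : ℝ) (hk : 0 < k) : ∃ s : ℝ, 1 ≤ s ∧ ∀ (j : ℕ) (x y : ℝ),
    s + k * j ≤ x → x ≤ s + k * (j + 1) → |y| ≤ Real.exp j →
    -(x + y * Complex.I : ℂ) ∈ logHalfPlane a k := by
  set s := 3 + k + 2 * |k * Real.log (2 * k)| + 2 * |a| with hs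
  have h1 := le_abs_self (k * Real.log (2 * k))
  have h2 := neg_abs_le a
  have h3 := abs_nonneg (k * Real.log (2 * k))
  have h4 := abs_nonneg a
  refine ⟨s, by linarith, fun j x y hx1 hx2 hy => ?_⟩
  have hj : (0 : ℝ) ≤ j := j.cast_nonneg
  have hkj : 0 ≤ k * j := by positivity
  have hs0 : 0 < s := by linarith
  have hre : (-(x + y * Complex.I : ℂ)).re = -x := by simp
  have him : (-(x + y * Complex.I : ℂ)).im = -y := by simp
  refine ⟨by rw [hre]; linarith, ?_⟩
  rw [hre, him, neg_sq, neg_sq]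
  have he1 : 1 ≤ Real.exp j := Real.one_le_exp hj
  have he2 : (j : ℝ) ≤ Real.exp j := by linarith [Real.add_one_le_exp (j : ℝ)]
  have hz : 0 < s + 2 * k + 1 := by linarith
  have hb : x ^ 2 + y ^ 2 ≤ (Real.exp j * (s + 2 * k + 1)) ^ 2 := by
    have : x + |y| ≤ Real.exp j * (s + 2 * k + 1) := by nlinarith
    calc x ^ 2 + y ^ 2 = x ^ 2 + |y| ^ 2 := by rw [sq_abs]
      _ ≤ (x + |y|) ^ 2 := by nlinarith [abs_nonneg y]
      _ ≤ _ := pow_le_pow_left₀ (by nlinarith [abs_nonneg y]) this 2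
  have hxpos : 0 < x := by linarith
  have hlog : Real.log (x ^ 2 + y ^ 2) ≤ 2 * (j + Real.log (s + 2 * k + 1)) := by
    refine (Real.log_le_log (by positivity) hb).trans ?_
    rw [Real.log_pow, Real.log_mul (Real.exp_ne_zero _) hz.ne', Real.log_exp]
    norm_num
  -- The tangent of the logarithm at `2 * k` has slope 1/(2k), so this term costs only half of `s`;
  -- the other half absorbs the constants, whence the factors 2 in `s`.
  have hlog2 : k * Real.log (s + 2 * k + 1) ≤
      (s + 2 * k + 1) / 2 - k + k * Real.log (2 * k) := by
    have h := Real.log_le_sub_one_of_pos (show 0 < (s + 2 * k + 1) / (2 * k) by positivity)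
    rw [Real.log_div hz.ne' (by positivity)] at h
    have h' := mul_le_mul_of_nonneg_left h hk.le
    have : k * ((s + 2 * k + 1) / (2 * k) - 1) = (s + 2 * k + 1) / 2 - k := by
      field_simp
    rw [this] at h'
    linarith
  have := mul_le_mul_of_nonneg_left hlog (by positivity : 0 ≤ k / 2)
  have h5 := le_abs_self a
  nlinarith

theorem norm_integral_sub_integral_le (σ u Y : ℝ) (n : ℕ) (hs : 1 ≤ σ) (hY : 1 ≤ Y) (hn : 2 ≤ n) :
    ‖(∫ y : ℝ, Complex.exp (u * (σ + y * Complex.I)) * ((σ + y * Complex.I : ℂ) ^ (n + 1))⁻¹) -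
      ∫ y in (-Y)..Y, Complex.exp (u * (σ + y * Complex.I)) *
        ((σ + y * Complex.I : ℂ) ^ (n + 1))⁻¹‖ ≤ Real.pi * (Real.exp (u * σ) * (Y ^ (n - 1))⁻¹) := by
  set f : ℝ → ℂ := fun y => Complex.exp (u * (σ + y * Complex.I)) *
    ((σ + y * Complex.I : ℂ) ^ (n + 1))⁻¹ with hf
  have hσ : 0 < σ := by linarith
  have hne : ∀ y : ℝ, (σ + y * Complex.I : ℂ) ≠ 0 := fun y h => by
    have := congrArg Complex.re h
    simp at this
    exact hσ.ne' this
  have hnorm : ∀ y : ℝ, ‖f y‖ = Real.exp (u * σ) * (‖(σ + y * Complex.I : ℂ)‖ ^ (n + 1))⁻¹ := by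
    intro y
    simp only [hf, norm_mul, norm_inv, norm_pow, Complex.norm_exp]
    simp
  have hint : Integrable f := by
    refine ((integrable_inv_pow σ hσ n (by lia)).norm.const_mul (Real.exp (u * σ))).mono ?_
      (ae_of_all _ fun y => ?_)
    · refine Continuous.aestronglyMeasurable ?_
      exact Continuous.mul (by fun_prop) (Continuous.inv₀ (by fun_prop) fun y => pow_ne_zero _ (hne y))
    · rw [hnorm]
      simp
  rw [intervalIntegral.integral_of_le (by linarith), ← integral_add_compl
    (measurableSet_Ioc (a := -Y) (b := Y)) hint, add_sub_cancel_left]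
  have hgi : Integrable fun y : ℝ => Real.exp (u * σ) * (Y ^ (n - 1))⁻¹ * (1 + y ^ 2)⁻¹ :=
    integrable_inv_one_add_sq.const_mul _
  refine (norm_integral_le_of_norm_le hgi.integrableOn
    ((ae_restrict_iff' measurableSet_Ioc.compl).2 (ae_of_all _ fun y hy => ?_))).trans ?_
  · rw [hnorm, mul_assoc, ← mul_inv]
    have hy' : Y ≤ |y| := by
      by_contra h
      push Not at h
      exact hy ⟨(abs_lt.1 h).1, (abs_lt.1 h).2.le⟩
    have h1 : Y ≤ ‖(σ + y * Complex.I : ℂ)‖ := by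
      refine hy'.trans ?_
      simpa using (Complex.abs_im_le_norm (σ + y * Complex.I : ℂ))
    have h2 : 1 + y ^ 2 ≤ ‖(σ + y * Complex.I : ℂ)‖ ^ 2 := by
      rw [← norm_ge_of_re_im]; nlinarith
    have : 0 < Y := by linarith
    gcongr
    rw [show n + 1 = (n - 1) + 2 by lia, pow_add _ (n - 1) 2]
    gcongr
  · refine (setIntegral_le_integral hgi (ae_of_all _ fun y => ?_)).trans ?_
    · have : 0 < Y := by linarith
      simp only [Pi.zero_apply]
      positivity
    · rw [integral_const_mul, integral_univ_inv_one_add_sq, mul_comm]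

/-- Passing from one vertical segment to the next changes the integral by two horizontal pieces of
length `k` and two vertical pieces, all at height at least e^J. There |ζ|^{-(n+1)} outweighs both
e^{t Re ζ} and the length, so the changes are dominated by a geometric series and the bound does not
depend on `J`. -/
theorem norm_integral_staircase_le (φ : ℂ → ℂ) (s k t M : ℝ) (hk : 0 < k) (hs : 1 ≤ s)
    (ht : 0 ≤ t) (hM : 0 ≤ M) (n : ℕ) (hn : k * t + 3 ≤ n + 1)
    (hφd : ∀ (j : ℕ) (x y : ℝ), s + k * j ≤ x → x ≤ s + k * (j + 1) → |y| ≤ Real.exp j →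
      DifferentiableAt ℂ φ (x + y * Complex.I))
    (hφ : ∀ (j : ℕ) (x y : ℝ), s + k * j ≤ x → x ≤ s + k * (j + 1) → |y| ≤ Real.exp j →
      ‖φ (x + y * Complex.I)‖ ≤ M * Real.exp (t * x) * (‖(x + y * Complex.I : ℂ)‖ ^ (n + 1))⁻¹)
    (J : ℕ) :
    ‖∫ y in (-Real.exp J)..Real.exp J, φ (((s + k * J : ℝ) : ℂ) + y * Complex.I)‖ ≤
      M * (2 + 2 * (2 * k + 2 * Real.exp 1)) * Real.exp (t * (s + k)) := by
  set E := M * (2 * k + 2 * Real.exp 1) * Real.exp (t * (s + k)) with hE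
  have hE0 : 0 ≤ E := by positivity
  have key : ∀ J : ℕ, ‖∫ y in (-Real.exp J)..Real.exp J,
      φ (((s + k * J : ℝ) : ℂ) + y * Complex.I)‖ ≤
      2 * M * Real.exp (t * s) + E * ∑ j ∈ Finset.range J, (1 / 2 : ℝ) ^ j := by
    intro J
    induction J with
    | zero =>
      have h := intervalIntegral.norm_integral_le_of_norm_le_const (a := -1) (b := 1)
        (f := fun y : ℝ => φ (s + y * Complex.I)) (C := M * Real.exp (t * s)) (by
          intro y hy
          rw [uIoc_of_le (by norm_num)] at hy
          refine (hφ 0 s y (by simp) (by simp; linarith) (by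
            simp only [CharP.cast_eq_zero, Real.exp_zero]; exact abs_le.2 ⟨hy.1.le, hy.2⟩)).trans ?_
          refine mul_le_of_le_one_right (by positivity) (inv_le_one_of_one_le₀ (one_le_pow₀ ?_))
          refine hs.trans ?_
          simpa using Complex.re_le_norm (s + y * Complex.I : ℂ))
      rw [show |(1 : ℝ) - -1| = 2 by norm_num] at h
      simp only [CharP.cast_eq_zero, Real.exp_zero, mul_zero, add_zero, Finset.range_zero,
        Finset.sum_empty]
      linarith
    | succ J ih =>
      set σ := s + k * J with hσ
      set σ' := s + k * (J + 1 : ℕ) with hσ'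
      have hσσ' : σ' = σ + k := by rw [hσ, hσ']; push_cast; ring
      set Y := Real.exp J with hY
      set Y' := Real.exp (J + 1 : ℕ) with hY'
      have hYY : Y' = Real.exp 1 * Y := by rw [hY, hY', ← Real.exp_add]; push_cast; ring_nf
      have hYpos : 0 < Y := Real.exp_pos _
      have he1 : 1 ≤ Real.exp 1 := Real.one_le_exp zero_le_one
      have hYle : Y ≤ Y' := by rw [hYY]; nlinarith
      have hσpos : 1 ≤ σ := by
        have : 0 ≤ k * J := by positivity
        linarith
      -- the pointwise bound at height at least `Y`
      set D := M * Real.exp (t * σ') * (Y ^ (n + 1))⁻¹ with hD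
      have hD0 : 0 ≤ D := by positivity
      have hbound : ∀ (j : ℕ) (x y : ℝ), s + k * j ≤ x → x ≤ s + k * (j + 1) → |y| ≤ Real.exp j →
          x ≤ σ' → Y ≤ |y| → ‖φ (x + y * Complex.I)‖ ≤ D := by
        intro j x y h1 h2 h3 h4 h5
        refine (hφ j x y h1 h2 h3).trans ?_
        have h6 : Y ≤ ‖(x + y * Complex.I : ℂ)‖ :=
          h5.trans (by simpa using Complex.abs_im_le_norm (x + y * Complex.I : ℂ))
        rw [hD]
        gcongr
      -- The exponent of the left side is (kt - n)J up to constants, at most -J by `hn`.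
      have hDE : (2 * k + 2 * Y') * D ≤ E * (1 / 2) ^ J := by
        have h1 : (2 * k + 2 * Y') ≤ (2 * k + 2 * Real.exp 1) * Y := by
          have : 1 ≤ Y := Real.one_le_exp (by positivity)
          rw [hYY]; nlinarith
        have h2 : Y * (Real.exp (t * σ') * (Y ^ (n + 1))⁻¹) ≤
            Real.exp (t * (s + k)) * (1 / 2) ^ J := by
          have h3 : (1 / 2 : ℝ) ^ J ≥ Real.exp (-J) := by
            rw [one_div, inv_pow, Real.exp_neg, ge_iff_le, inv_le_inv₀ (by positivity) (by positivity)]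
            have : (2 : ℝ) ≤ Real.exp 1 := by linarith [Real.add_one_le_exp (1 : ℝ)]
            calc (2 : ℝ) ^ J ≤ Real.exp 1 ^ J := by gcongr
              _ = Real.exp J := by rw [← Real.exp_nat_mul]; ring_nf
          refine le_trans ?_ (mul_le_mul_of_nonneg_left h3 (Real.exp_pos _).le)
          rw [hY, ← Real.exp_nat_mul, ← Real.exp_neg, ← Real.exp_add, ← Real.exp_add,
            ← Real.exp_add]
          refine Real.exp_le_exp.2 ?_
          rw [hσ']
          push_cast
          have := mul_le_mul_of_nonneg_right hn (J.cast_nonneg : (0 : ℝ) ≤ J)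
          nlinarith [(J.cast_nonneg : (0 : ℝ) ≤ J)]
        calc (2 * k + 2 * Y') * D ≤ ((2 * k + 2 * Real.exp 1) * Y) * D := by gcongr
          _ = M * (2 * k + 2 * Real.exp 1) * (Y * (Real.exp (t * σ') * (Y ^ (n + 1))⁻¹)) := by
            rw [hD]; ring
          _ ≤ M * (2 * k + 2 * Real.exp 1) * (Real.exp (t * (s + k)) * (1 / 2) ^ J) := by gcongr
          _ = _ := by rw [hE]; ring
      -- Cauchy's theorem on the rectangle
      have hrect := Complex.integral_boundary_rect_eq_zero_of_differentiableOn φ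
        (σ + (-Y : ℝ) * Complex.I) (σ' + Y * Complex.I) (by
          intro z hz
          rw [Complex.mem_reProdIm] at hz
          simp only [Complex.add_re, Complex.ofReal_re, Complex.mul_re, Complex.I_re, mul_zero,
            Complex.ofReal_im, Complex.I_im, mul_one, sub_self, add_zero, Complex.add_im,
            Complex.mul_im, zero_add] at hz
          rw [uIcc_of_le (by linarith), uIcc_of_le (by linarith)] at hz
          have := hφd J z.re z.im hz.1.1 (by
            have := hz.1.2
            rw [hσ'] at this
            push_cast at this
            exact this) (abs_le.2 hz.2)
          rw [Complex.re_add_im] at this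
          exact this.differentiableWithinAt)
      simp only [Complex.add_re, Complex.ofReal_re, Complex.mul_re, Complex.I_re, mul_zero,
            Complex.ofReal_im, Complex.I_im, mul_one, sub_self, add_zero, Complex.add_im,
            Complex.mul_im, zero_add, smul_eq_mul] at hrect
      have hhor : ∀ y : ℝ, |y| = Y → ‖∫ x in σ..σ', φ (x + y * Complex.I)‖ ≤ D * k := by
        intro y hy
        have h := intervalIntegral.norm_integral_le_of_norm_le_const (a := σ) (b := σ')
          (f := fun x : ℝ => φ (x + y * Complex.I)) (C := D) (by
            intro x hx
            rw [uIoc_of_le (by linarith)] at hx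
            exact hbound J x y hx.1.le (by
              have := hx.2
              rw [hσ'] at this
              push_cast at this
              exact this) hy.le hx.2 hy.ge)
        rwa [hσσ', add_sub_cancel_left, abs_of_pos hk, ← hσσ'] at h
      have hcont : ContinuousOn (fun y : ℝ => φ (σ' + y * Complex.I)) (Icc (-Y') Y') := by
        intro y hy
        have h1 := (hφd (J + 1) σ' y le_rfl (by rw [hσ']; linarith) (abs_le.2 hy)).continuousAt
        have h2 : ContinuousAt (fun y : ℝ => (σ' + y * Complex.I : ℂ)) y := by fun_prop
        exact (ContinuousAt.comp (g := φ) (f := fun y : ℝ => (σ' + y * Complex.I : ℂ)) h1 h2).continuousWithinAt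
      have hii : ∀ c d, -Y' ≤ c → c ≤ d → d ≤ Y' →
          IntervalIntegrable (fun y : ℝ => φ (σ' + y * Complex.I)) volume c d := by
        intro c d h1 h2 h3
        refine ContinuousOn.intervalIntegrable ?_
        rw [uIcc_of_le h2]
        exact hcont.mono (Icc_subset_Icc h1 h3)
      have hver : ∀ c d, -Y' ≤ c → c ≤ d → d ≤ Y' → (∀ y ∈ Ioc c d, Y ≤ |y|) → d - c ≤ Y' →
          ‖∫ y in c..d, φ (σ' + y * Complex.I)‖ ≤ D * Y' := by
        intro c d h1 h2 h3 h4 h5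
        refine (intervalIntegral.norm_integral_le_of_norm_le_const (C := D) (by
            intro y hy
            rw [uIoc_of_le h2] at hy
            exact hbound (J + 1) σ' y le_rfl (by rw [hσ']; linarith)
              (abs_le.2 ⟨by linarith [hy.1], hy.2.trans h3⟩) le_rfl (h4 y hy))).trans ?_
        rw [abs_of_nonneg (sub_nonneg.2 h2)]
        gcongr
      have hv1 := hver (-Y') (-Y) le_rfl (by linarith) (by linarith) (fun y hy => by
        rw [abs_of_neg (by linarith [hy.2])]; linarith [hy.2]) (by linarith)
      have hv2 := hver Y Y' (by linarith) hYle le_rfl (fun y hy => by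
        rw [abs_of_pos (by linarith [hy.1])]; exact hy.1.le) (by linarith)
      have hsplit : ∫ y in (-Y')..Y', φ (σ' + y * Complex.I) =
          (∫ y in (-Y')..(-Y), φ (σ' + y * Complex.I)) + (∫ y in (-Y)..Y, φ (σ' + y * Complex.I)) +
          ∫ y in Y..Y', φ (σ' + y * Complex.I) := by
        have hYn : -Y ≤ Y := by linarith
        have hYn' : -Y' ≤ -Y := by linarith
        rw [intervalIntegral.integral_add_adjacent_intervals
            (hii _ _ le_rfl hYn' (hYn.trans hYle)) (hii _ _ hYn' hYn hYle),
          intervalIntegral.integral_add_adjacent_intervals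
            (hii _ _ le_rfl (hYn'.trans hYn) hYle) (hii _ _ (hYn'.trans hYn) hYle le_rfl)]
      set h₁ := ∫ x in σ..σ', φ (x + (-Y : ℝ) * Complex.I) with hh₁
      set h₂ := ∫ x in σ..σ', φ (x + Y * Complex.I) with hh₂
      have hn1 : ‖h₁‖ ≤ D * k := hhor (-Y) (by rw [abs_neg, abs_of_pos hYpos])
      have hn2 : ‖h₂‖ ≤ D * k := hhor Y (abs_of_pos hYpos)
      have hshift : ∫ y in (-Y)..Y, φ (σ' + y * Complex.I) =
          (∫ y in (-Y)..Y, φ (σ + y * Complex.I)) + Complex.I * (h₁ - h₂) := by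
        linear_combination (-Complex.I) * hrect + ((∫ y in (-Y)..Y, φ (σ' + y * Complex.I)) -
          ∫ y in (-Y)..Y, φ (σ + y * Complex.I)) * Complex.I_sq
      rw [hsplit, hshift, Finset.sum_range_succ]
      have hn3 : ‖Complex.I * (h₁ - h₂)‖ ≤ D * k + D * k := by
        rw [norm_mul, Complex.norm_I, one_mul]
        exact (norm_sub_le _ _).trans (add_le_add hn1 hn2)
      have e1 := norm_add₃_le (a := ∫ y in (-Y')..(-Y), φ (σ' + y * Complex.I))
        (b := (∫ y in (-Y)..Y, φ (σ + y * Complex.I)) + Complex.I * (h₁ - h₂))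
        (c := ∫ y in Y..Y', φ (σ' + y * Complex.I))
      have e2 := norm_add_le (∫ y in (-Y)..Y, φ (σ + y * Complex.I)) (Complex.I * (h₁ - h₂))
      nlinarith
  refine (key J).trans ?_
  have hgeo : ∑ j ∈ Finset.range J, (1 / 2 : ℝ) ^ j ≤ 2 := by
    rw [geom_sum_eq (by norm_num)]
    have : (0 : ℝ) ≤ (1 / 2) ^ J := by positivity
    rw [div_le_iff_of_neg (by norm_num)]
    linarith
  have h1 : Real.exp (t * s) ≤ Real.exp (t * (s + k)) := by
    gcongr
    linarith
  calc _ ≤ 2 * M * Real.exp (t * (s + k)) + E * 2 := by gcongr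
    _ = _ := by rw [hE]; ring

theorem isOpen_logHalfPlane (a : ℝ) {k : ℝ} (hk : 0 ≤ k) : IsOpen (logHalfPlane a k) := by
  have h1 : IsOpen {w : ℂ | w.re < -k} := isOpen_lt Complex.continuous_re continuous_const
  have h2 : ContinuousOn (fun w : ℂ => w.re + k / 2 * Real.log (w.re ^ 2 + w.im ^ 2))
      {w : ℂ | w.re < -k} := by
    refine Complex.continuous_re.continuousOn.add (continuousOn_const.mul
      (ContinuousOn.log (by fun_prop) fun w hw => ?_))
    have hw' : w.re < -k := hw
    nlinarith [sq_nonneg w.im, mul_pos_of_neg_of_neg (by linarith : w.re < 0) (by linarith : w.re < 0)]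
  exact h2.isOpen_inter_preimage h1 (isOpen_Iio (a := a))

theorem HasFormalDevelopment.exists_bound {g : ℂ → ℂ} {H : Set ℂ} {R : Set ℝ} {A : ℝ → ℂ}
    (h : HasFormalDevelopment g H R A) (x : ℝ) (F : Finset ℝ) (hF : (F : Set ℝ) = R ∩ Iio x) :
    ∃ C X : ℝ, ∀ w ∈ H, w.re ≤ X →
      ‖g w - ∑ β ∈ F, A β * Complex.exp (β * w)‖ ≤ C * Real.exp (x * w.re) := by
  obtain ⟨C, hC⟩ := (h x).bound
  rw [eventually_inf_principal, eventually_comap] at hC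
  obtain ⟨X, hX⟩ := eventually_atBot.1 hC
  refine ⟨C, X, fun w hw hwX => ?_⟩
  have h1 := hX w.re hwX w rfl hw
  rw [← hF, finsum_mem_coe_finset] at h1
  rwa [Complex.norm_exp, Complex.re_ofReal_mul] at h1

/-- Perron's integral on Re ζ = s + kJ does not depend on `J`, and its part beyond height e^J is of
size e^{(ku - n + 1)J}. This is what requires n ≥ ku + 2. -/
theorem tendsto_integral_cexp_div_pow (s k u : ℝ) (hk : 0 < k) (hs : 1 ≤ s) (n : ℕ)
    (hn : k * u + 3 ≤ n + 1) (hn2 : 2 ≤ n) :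
    Tendsto (fun J : ℕ => ∫ y in (-Real.exp J)..Real.exp J,
      Complex.exp (u * (((s + k * J : ℝ) : ℂ) + y * Complex.I)) *
        ((((s + k * J : ℝ) : ℂ) + y * Complex.I) ^ (n + 1))⁻¹) atTop
      (𝓝 (2 * Real.pi * ((max u 0 ^ n / n.factorial : ℝ) : ℂ))) := by
  have hσ : ∀ J : ℕ, 1 ≤ s + k * J := fun J => by
    have : 0 ≤ k * J := by positivity
    linarith
  rw [tendsto_iff_norm_sub_tendsto_zero]
  have hlim : Tendsto (fun J : ℕ => Real.pi * Real.exp (u * s) * Real.exp (-(J : ℝ))) atTop (𝓝 0) := by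
    have h := (Real.tendsto_exp_neg_atTop_nhds_zero.comp
      (tendsto_natCast_atTop_atTop (R := ℝ))).const_mul (Real.pi * Real.exp (u * s))
    simpa using h
  refine squeeze_zero (fun _ => norm_nonneg _) (fun J => ?_) hlim
  have hJ : (0 : ℝ) ≤ J := J.cast_nonneg
  have h := norm_integral_sub_integral_le (s + k * J) u (Real.exp J) n (hσ J)
    (Real.one_le_exp hJ) hn2
  rw [integral_cexp_div_pow _ (by linarith [hσ J]) n (by lia), norm_sub_rev] at h
  refine h.trans ?_
  rw [mul_assoc Real.pi, ← Real.exp_nat_mul, ← Real.exp_neg, ← Real.exp_add, ← Real.exp_add]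
  refine mul_le_mul_of_nonneg_left (Real.exp_le_exp.2 ?_) Real.pi_pos.le
  have h3 : ((n - 1 : ℕ) : ℝ) = n - 1 := by rw [Nat.cast_sub (by lia)]; simp
  rw [h3]
  nlinarith [mul_le_mul_of_nonneg_right hn hJ]

/-- The Riesz means of the coefficients of an irrational series on a logarithmic half-plane grow at
most exponentially, provided that their order exceeds `k t + 2`. -/
theorem exists_norm_sum_mul_pow_le {R : Set ℝ} (hR : IsExponentSet R) {A : ℝ → ℂ} {a k : ℝ}
    (hk : 0 < k) {g : ℂ → ℂ} (hg : IsIrrationalSeries g (logHalfPlane a k) R A) :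
    ∃ C b : ℝ, 0 ≤ C ∧ 0 ≤ b ∧ ∀ t : ℝ, 0 ≤ t → ∀ n : ℕ, k * t + 2 ≤ n → ∀ X : ℝ, t ≤ X →
      ∀ F : Finset ℝ, (F : Set ℝ) = R ∩ Iio X →
      ‖∑ β ∈ F, A β * ((max (t - β) 0 ^ n / n.factorial : ℝ) : ℂ)‖ ≤ C * Real.exp (t * b) := by
  obtain ⟨s, hs, hH⟩ := exists_staircase a k hk
  obtain ⟨M, hM⟩ := hg.bounded
  have hM0 : 0 ≤ M := by
    have h := hM _ (hH 0 s 0 (by simp) (by simp; linarith) (by simp))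
    exact (norm_nonneg _).trans h
  refine ⟨M * (2 + 2 * (2 * k + 2 * Real.exp 1)), s + k, by positivity, by linarith, ?_⟩
  intro t ht n hn X hX F hF
  have hn0 : n ≠ 0 := by
    rintro rfl
    have := mul_nonneg hk.le ht
    simp at hn
    linarith
  have hn2 : 2 ≤ n := by
    have := mul_nonneg hk.le ht
    exact_mod_cast (by linarith : (2 : ℝ) ≤ n)
  -- it suffices to treat one value of `X`
  set X' := t + 2 / k with hX'
  have hX't : t ≤ X' := by
    have : 0 < 2 / k := by positivity
    linarith
  set F' := (hR.finite_inter_Iio X').toFinset with hF'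
  have hsum : ∀ (Z : ℝ) (E : Finset ℝ), t ≤ Z → (E : Set ℝ) = R ∩ Iio Z →
      ∑ β ∈ E, A β * ((max (t - β) 0 ^ n / n.factorial : ℝ) : ℂ) =
      ∑ β ∈ (hR.finite_inter_Iio t).toFinset,
        A β * ((max (t - β) 0 ^ n / n.factorial : ℝ) : ℂ) := by
    intro Z E hZ hE
    symm
    refine Finset.sum_subset (fun β hβ => ?_) (fun β hβ hβ' => ?_)
    · rw [Set.Finite.mem_toFinset] at hβ
      rw [← Finset.mem_coe, hE]
      exact ⟨hβ.1, lt_of_lt_of_le hβ.2 hZ⟩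
    · rw [Set.Finite.mem_toFinset] at hβ'
      rw [← Finset.mem_coe, hE] at hβ
      have : t ≤ β := by
        by_contra h
        exact hβ' ⟨hβ.1, not_le.1 h⟩
      simp [max_eq_right (sub_nonpos.2 this), hn0]
  rw [hsum X F hX hF, ← hsum X' F' hX't (by simp [hF'])]
  -- The integral of `φ` over the `J`-th segment is bounded uniformly in `J` by the staircase
  -- estimate. Replacing `g` by its finite development, which costs o(1), shows that it tends to 2π
  -- times the Riesz mean.
  set φ : ℂ → ℂ := fun ζ => g (-ζ) * (Complex.exp (t * ζ) * (ζ ^ (n + 1))⁻¹) with hφ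
  have hne : ∀ x y : ℝ, 1 ≤ x → (x + y * Complex.I : ℂ) ≠ 0 := fun x y hx h => by
    have := congrArg Complex.re h
    simp at this
    linarith
  have hopen : IsOpen (logHalfPlane a k) := isOpen_logHalfPlane a hk.le
  have hxs : ∀ (j : ℕ) (x : ℝ), s + k * j ≤ x → 1 ≤ x := fun j x h => by
    have : 0 ≤ k * j := by positivity
    linarith
  have hV := norm_integral_staircase_le φ s k t M hk hs ht hM0 n (by linarith) (by
      intro j x y h1 h2 h3
      have h4 := hg.holomorphic.differentiableAt (hopen.mem_nhds (hH j x y h1 h2 h3))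
      have h5 := hne x y (hxs j x h1)
      refine DifferentiableAt.mul ?_ ?_
      · exact DifferentiableAt.comp (g := g) (f := fun ζ => -ζ) _ h4 (by fun_prop)
      · exact DifferentiableAt.mul (by fun_prop) (DifferentiableAt.inv (by fun_prop) (pow_ne_zero _ h5)))
    (by
      intro j x y h1 h2 h3
      simp only [hφ, norm_mul, norm_inv, norm_pow, Complex.norm_exp, Complex.re_ofReal_mul]
      rw [← mul_assoc]
      gcongr
      · exact hM _ (hH j x y h1 h2 h3)
      · simp)
  -- the limit of the integrals
  obtain ⟨C, Y, hC⟩ := hg.development.exists_bound X' F' (by simp [hF'])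
  set T : ℝ → ℕ → ℂ := fun u J => ∫ y in (-Real.exp J)..Real.exp J,
      Complex.exp (u * (((s + k * J : ℝ) : ℂ) + y * Complex.I)) *
        ((((s + k * J : ℝ) : ℂ) + y * Complex.I) ^ (n + 1))⁻¹ with hT
  have hσ : ∀ J : ℕ, 1 ≤ s + k * J := fun J => hxs J _ le_rfl
  have hci : ∀ (J : ℕ) (u : ℝ), Continuous fun y : ℝ =>
      Complex.exp (u * (((s + k * J : ℝ) : ℂ) + y * Complex.I)) *
        ((((s + k * J : ℝ) : ℂ) + y * Complex.I) ^ (n + 1))⁻¹ := fun J u =>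
    Continuous.mul (by fun_prop) (Continuous.inv₀ (by fun_prop) fun y =>
      pow_ne_zero _ (hne _ y (hσ J)))
  have hrem : ∀ᶠ J : ℕ in atTop, ‖(∫ y in (-Real.exp J)..Real.exp J,
      φ (((s + k * J : ℝ) : ℂ) + y * Complex.I)) - ∑ β ∈ F', A β * T (t - β) J‖ ≤
      2 * |C| * Real.exp (-(J : ℝ)) := by
    have hev : ∀ᶠ J : ℕ in atTop, -(s + k * (J : ℝ)) ≤ Y := by
      have h1 : Tendsto (fun J : ℕ => s + k * (J : ℝ)) atTop atTop :=
        tendsto_atTop_add_const_left _ _ ((tendsto_natCast_atTop_atTop (R := ℝ)).const_mul_atTop hk)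
      filter_upwards [h1.eventually_ge_atTop (-Y)] with J hJ
      linarith
    filter_upwards [hev] with J hJ
    have hJ0 : (0 : ℝ) ≤ J := J.cast_nonneg
    have hcφ : IntervalIntegrable (fun y : ℝ => φ (((s + k * J : ℝ) : ℂ) + y * Complex.I)) volume
        (-Real.exp J) (Real.exp J) := by
      refine ContinuousOn.intervalIntegrable fun y hy => ?_
      rw [uIcc_of_le (by linarith [Real.exp_pos J])] at hy
      have hmem := hH J (s + k * J) y le_rfl (by linarith) (abs_le.2 hy)
      have h4 := (hg.holomorphic.differentiableAt (hopen.mem_nhds hmem)).continuousAt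
      have h5 : ContinuousAt (fun y : ℝ => -(((s + k * J : ℝ) : ℂ) + y * Complex.I)) y := by fun_prop
      have h6 : ContinuousAt (fun y : ℝ => g (-(((s + k * J : ℝ) : ℂ) + y * Complex.I))) y :=
        ContinuousAt.comp (g := g) (f := fun y : ℝ => -(((s + k * J : ℝ) : ℂ) + y * Complex.I)) h4 h5
      exact (h6.mul (hci J t).continuousAt).continuousWithinAt
    have hsumT : ∑ β ∈ F', A β * T (t - β) J = ∫ y in (-Real.exp J)..Real.exp J,
        ∑ β ∈ F', A β * (Complex.exp ((t - β : ℝ) * (((s + k * J : ℝ) : ℂ) + y * Complex.I)) *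
        ((((s + k * J : ℝ) : ℂ) + y * Complex.I) ^ (n + 1))⁻¹) := by
      rw [intervalIntegral.integral_finsetSum]
      · exact Finset.sum_congr rfl fun β _ => (intervalIntegral.integral_const_mul _ _).symm
      · exact fun β _ => ((hci J (t - β)).const_mul _).intervalIntegrable _ _
    have hcs : IntervalIntegrable (fun y : ℝ =>
        ∑ β ∈ F', A β * (Complex.exp ((t - β : ℝ) * (((s + k * J : ℝ) : ℂ) + y * Complex.I)) *
        ((((s + k * J : ℝ) : ℂ) + y * Complex.I) ^ (n + 1))⁻¹)) volume
        (-Real.exp J) (Real.exp J) :=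
      (continuous_finsetSum _ fun β _ => (hci J (t - β)).const_mul _).intervalIntegrable _ _
    rw [hsumT, ← intervalIntegral.integral_sub hcφ hcs]
    have hkX : 2 / k * k = 2 := by field_simp
    refine (intervalIntegral.norm_integral_le_of_norm_le_const
      (C := |C| * Real.exp (-(2 * J))) fun y hy => ?_).trans ?_
    · rw [uIoc_of_le (by linarith [Real.exp_pos J])] at hy
      set ζ : ℂ := ((s + k * J : ℝ) : ℂ) + y * Complex.I with hζ
      have hζre : ζ.re = s + k * J := by simp [hζ]
      have hmem : -ζ ∈ logHalfPlane a k :=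
        hH J (s + k * J) y le_rfl (by linarith) (abs_le.2 ⟨hy.1.le, hy.2⟩)
      have hb := hC _ hmem (by rw [Complex.neg_re, hζre]; exact hJ)
      have heq : φ ζ - ∑ β ∈ F', A β * (Complex.exp ((t - β : ℝ) * ζ) * (ζ ^ (n + 1))⁻¹) =
          (g (-ζ) - ∑ β ∈ F', A β * Complex.exp (β * -ζ)) *
            (Complex.exp (t * ζ) * (ζ ^ (n + 1))⁻¹) := by
        rw [sub_mul, Finset.sum_mul]
        congr 1
        refine Finset.sum_congr rfl fun β _ => ?_
        rw [show ((t - β : ℝ) : ℂ) * ζ = β * -ζ + t * ζ by push_cast; ring, Complex.exp_add]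
        ring
      rw [heq, norm_mul, norm_mul, norm_inv, norm_pow, Complex.norm_exp, Complex.re_ofReal_mul,
        hζre]
      rw [Complex.neg_re, hζre] at hb
      have hζ1 : (‖ζ‖ ^ (n + 1))⁻¹ ≤ 1 := by
        refine inv_le_one_of_one_le₀ (one_le_pow₀ ((hσ J).trans ?_))
        rw [← hζre]
        exact Complex.re_le_norm ζ
      calc _ ≤ (C * Real.exp (X' * -(s + k * J))) * (Real.exp (t * (s + k * J)) * 1) := by
            gcongr
            exact (norm_nonneg _).trans hb
        _ = C * Real.exp (-(2 / k * s) - 2 * J) := by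
            rw [mul_one, mul_assoc, ← Real.exp_add, hX']
            congr 2
            linear_combination (-J : ℝ) * hkX
        _ ≤ |C| * Real.exp (-(2 * J)) := by
            have : 0 ≤ 2 / k * s := by positivity
            gcongr
            · exact le_abs_self C
            · linarith
    · rw [sub_neg_eq_add, abs_of_pos (show 0 < Real.exp J + Real.exp J by positivity)]
      apply le_of_eq
      have : Real.exp (-(2 * (J : ℝ))) = Real.exp (-J) * (Real.exp J)⁻¹ := by
        rw [← Real.exp_neg, ← Real.exp_add]; ring_nf
      rw [this]
      field_simp
      ring
  have hlimT : Tendsto (fun J : ℕ => ∑ β ∈ F', A β * T (t - β) J) atTop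
      (𝓝 (∑ β ∈ F', A β * (2 * Real.pi * ((max (t - β) 0 ^ n / n.factorial : ℝ) : ℂ)))) := by
    refine tendsto_finsetSum _ fun β hβ => Tendsto.const_mul _ ?_
    refine tendsto_integral_cexp_div_pow s k (t - β) hk hs n ?_ hn2
    have hβ0 : 0 ≤ β := by
      rw [hF', Set.Finite.mem_toFinset] at hβ
      exact hR.nonneg hβ.1
    nlinarith
  have hlim0 : Tendsto (fun J : ℕ => 2 * |C| * Real.exp (-(J : ℝ))) atTop (𝓝 0) := by
    have h := (Real.tendsto_exp_neg_atTop_nhds_zero.comp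
      (tendsto_natCast_atTop_atTop (R := ℝ))).const_mul (2 * |C|)
    simpa using h
  have hlimV := (squeeze_zero_norm' hrem hlim0).add hlimT
  simp only [sub_add_cancel, zero_add] at hlimV
  have hfin := le_of_tendsto hlimV.norm (Eventually.of_forall hV)
  have hsumeq : ∑ β ∈ F', A β * (2 * Real.pi * ((max (t - β) 0 ^ n / n.factorial : ℝ) : ℂ)) =
      ((2 * Real.pi : ℝ) : ℂ) * ∑ β ∈ F', A β * ((max (t - β) 0 ^ n / n.factorial : ℝ) : ℂ) := by
    rw [Finset.mul_sum]
    exact Finset.sum_congr rfl fun β _ => by push_cast; ring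
  rw [hsumeq, norm_mul, Complex.norm_real, Real.norm_of_nonneg (by positivity)] at hfin
  refine le_trans ?_ hfin
  refine le_mul_of_one_le_left (norm_nonneg _) ?_
  linarith [Real.pi_gt_three]

/-! ### Cut-off sums of nodal polynomials. -/

/-- The function that is `1` on `(-∞, a]`, `0` on `(b, ∞)` and a step polynomial on `(a, b]`. -/
def cutoff (n : ℕ) (a b β : ℝ) : ℂ :=
  if β ≤ a then 1 else if β ≤ b then (stepPoly n).eval (((β - a) / (b - a) : ℝ) : ℂ) else 0

theorem cutoff_of_le {n : ℕ} {a b β : ℝ} (h : β ≤ a) : cutoff n a b β = 1 := if_pos h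

theorem cutoff_of_ge {n : ℕ} (hn : 1 ≤ n) {a b β : ℝ} (hab : a < b) (h : b ≤ β) :
    cutoff n a b β = 0 := by
  rw [cutoff, if_neg (not_le.2 (hab.trans_le h))]
  split_ifs with h1
  · obtain rfl := le_antisymm h1 h
    rw [div_self (by linarith)]
    obtain ⟨q, hq⟩ := one_sub_X_pow_dvd_stepPoly n
    rw [hq]
    simp [show n ≠ 0 by lia]
  · rfl

open Polynomial in
/-- The polynomial `∏ γ ∈ V, (X - γ)`. -/
def nodalPoly (V : Finset ℝ) : ℂ[X] := ∏ γ ∈ V, (X - C (γ : ℂ))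

theorem eval_nodalPoly (V : Finset ℝ) (x : ℝ) : (nodalPoly V).eval (x : ℂ) = nodal V x := by
  simp [nodalPoly, nodal, Polynomial.eval_prod]

theorem natDegree_nodalPoly (V : Finset ℝ) : (nodalPoly V).natDegree = V.card := by
  rw [nodalPoly, Polynomial.natDegree_prod_of_monic _ _ fun γ _ => Polynomial.monic_X_sub_C _]
  simp

open Polynomial in
/-- The step polynomial transported to `[a, b]`. -/
def stepPolyOn (n : ℕ) (a b : ℝ) : ℂ[X] :=
  (stepPoly n).comp (C (((b - a)⁻¹ : ℝ) : ℂ) * (X - C (a : ℂ)))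

theorem eval_stepPolyOn (n : ℕ) (a b : ℝ) (z : ℂ) :
    (stepPolyOn n a b).eval z = (stepPoly n).eval (((b - a)⁻¹ : ℝ) * (z - a)) := by
  simp [stepPolyOn]

open Polynomial in
theorem X_sub_C_pow_dvd_stepPolyOn (n : ℕ) {a b : ℝ} (hab : a < b) :
    (X - C (b : ℂ)) ^ n ∣ stepPolyOn n a b := by
  obtain ⟨q, hq⟩ := one_sub_X_pow_dvd_stepPoly n
  have hne : ((b : ℂ) - a) ≠ 0 := by
    rw [← Complex.ofReal_sub]; exact_mod_cast (sub_pos.2 hab).ne'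
  have h : (1 - X : ℂ[X]).comp (C (((b - a)⁻¹ : ℝ) : ℂ) * (X - C (a : ℂ))) =
      (X - C (b : ℂ)) * C (-(((b - a)⁻¹ : ℝ) : ℂ)) := by
    have h1 : C (((b - a)⁻¹ : ℝ) : ℂ) * (C (b : ℂ) - C (a : ℂ)) = 1 := by
      rw [← C_sub, ← C_mul, ← C_1]
      congr 1
      push_cast
      field_simp
    simp only [sub_comp, one_comp, X_comp, C_neg]
    linear_combination -h1
  rw [stepPolyOn, hq, mul_comp, pow_comp, h, mul_pow, mul_assoc]
  exact dvd_mul_right _ _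

open Polynomial in
theorem X_sub_C_pow_dvd_stepPolyOn_sub_one (n : ℕ) (hn : 1 ≤ n) (a b : ℝ) :
    (X - C (a : ℂ)) ^ n ∣ stepPolyOn n a b - 1 := by
  obtain ⟨q, hq⟩ := X_pow_dvd_stepPoly_sub_one n hn
  have h : stepPolyOn n a b - 1 =
      (stepPoly n - 1).comp (C (((b - a)⁻¹ : ℝ) : ℂ) * (X - C (a : ℂ))) := by
    simp [stepPolyOn]
  rw [h, hq, mul_comp, pow_comp, X_comp, mul_pow, mul_comm (C _ ^ n), mul_assoc]
  exact dvd_mul_right _ _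

-- The order `n` of contact of the step polynomial exceeds the degree of the nodal polynomial, so
-- `cutoff * nodal` is smooth enough for Taylor's formula: it is a superposition of truncated powers
-- of degree exactly `V.card`.
open Polynomial in
theorem cutoff_mul_nodal (n : ℕ) {a b : ℝ} (hab : a < b) (V : Finset ℝ) (hV0 : V.card ≠ 0)
    (hV : V.card < n) (β : ℝ) :
    cutoff n a b β * nodal V β = (-1) ^ (V.card + 1) *
      ∫ t in a..b, (((max (t - β) 0) ^ V.card / V.card.factorial : ℝ) : ℂ) *
        (derivative^[V.card + 1] (stepPolyOn n a b * nodalPoly V)).eval (t : ℂ) := by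
  rw [integral_posPart_pow_mul_iterate_derivative (stepPolyOn n a b * nodalPoly V) (nodalPoly V) β a b
    hab.le n ((X_sub_C_pow_dvd_stepPolyOn n hab).mul_right _) (by
      have : stepPolyOn n a b * nodalPoly V - nodalPoly V =
        (stepPolyOn n a b - 1) * nodalPoly V := by ring
      rw [this]
      exact (X_sub_C_pow_dvd_stepPolyOn_sub_one n (by lia) a b).mul_right _) V.card hV hV0
      (by rw [natDegree_nodalPoly]; lia), ← mul_assoc, ← mul_pow]
  simp only [mul_neg, mul_one, neg_neg, one_pow, one_mul]
  rw [cutoff]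
  split_ifs with h1 h2
  · rw [one_mul, eval_nodalPoly]
  · rw [eval_mul, eval_nodalPoly, eval_stepPolyOn]
    congr 2
    push_cast
    ring
  · rw [zero_mul]

theorem norm_eval_stepPolyOn_mul_nodalPoly_le (n : ℕ) {a b : ℝ} (hab : a < b) (V : Finset ℝ) (L : ℝ)
    (t : ℝ) (ht : t ∈ Icc a b) (hL : ∀ γ ∈ V, |t - γ| ≤ L) (ζ : ℂ) (hζ : ‖ζ - t‖ = 1) :
    ‖(stepPolyOn n a b * nodalPoly V).eval ζ‖ ≤
      ((2 * (1 + (b - a)⁻¹)) ^ (2 * n) + 1) * (L + 1) ^ V.card := by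
  have hba : 0 < b - a := sub_pos.2 hab
  have hinv : (b - a)⁻¹ * (b - a) = 1 := inv_mul_cancel₀ hba.ne'
  have hdist : ∀ x : ℝ, ‖ζ - x‖ ≤ 1 + |t - x| := by
    intro x
    calc ‖ζ - x‖ = ‖(ζ - t) + ((t - x : ℝ) : ℂ)‖ := by push_cast; ring_nf
      _ ≤ ‖ζ - t‖ + ‖((t - x : ℝ) : ℂ)‖ := norm_add_le _ _
      _ = 1 + |t - x| := by rw [hζ, Complex.norm_real, Real.norm_eq_abs]
  rw [Polynomial.eval_mul, norm_mul, eval_stepPolyOn]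
  refine mul_le_mul ?_ ?_ (norm_nonneg _) (by positivity)
  · refine (norm_eval_stepPoly_le _ _).trans ?_
    have h1 : ‖(((b - a)⁻¹ : ℝ) : ℂ) * (ζ - a)‖ ≤ 1 + (b - a)⁻¹ := by
      rw [norm_mul, Complex.norm_real, Real.norm_of_nonneg (by positivity)]
      have h2 := hdist a
      rw [abs_of_nonneg (by linarith [ht.1])] at h2
      calc (b - a)⁻¹ * ‖ζ - a‖ ≤ (b - a)⁻¹ * (1 + (b - a)) := by
            gcongr
            linarith [ht.2]
        _ = _ := by linear_combination hinv
    have h3 : ‖1 - (((b - a)⁻¹ : ℝ) : ℂ) * (ζ - a)‖ ≤ 1 + (b - a)⁻¹ := by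
      have h4 : 1 - (((b - a)⁻¹ : ℝ) : ℂ) * (ζ - a) = (((b - a)⁻¹ : ℝ) : ℂ) * (b - ζ) := by
        have : (((b - a)⁻¹ : ℝ) : ℂ) * (b - a) = 1 := by exact_mod_cast hinv
        linear_combination -this
      rw [h4, norm_mul, Complex.norm_real, Real.norm_of_nonneg (by positivity), norm_sub_rev]
      have h2 := hdist b
      rw [abs_of_nonpos (by linarith [ht.2])] at h2
      calc (b - a)⁻¹ * ‖ζ - b‖ ≤ (b - a)⁻¹ * (1 + (b - a)) := by
            gcongr
            linarith [ht.1]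
        _ = _ := by linear_combination hinv
    gcongr
    linarith
  · rw [nodalPoly, Polynomial.eval_prod, norm_prod]
    rw [← Finset.prod_const]
    refine Finset.prod_le_prod (fun _ _ => norm_nonneg _) fun γ hγ => ?_
    simp only [Polynomial.eval_sub, Polynomial.eval_X, Polynomial.eval_C]
    linarith [hdist γ, hL γ hγ]

-- The integral representation reduces the sum to Riesz means of order `V.card`. Cauchy's estimate
-- on unit circles bounds the derivative in the integrand; it is the source of the factorial.
open Polynomial in
theorem exists_norm_sum_cutoff_le {R : Set ℝ} (hR : IsExponentSet R) {A : ℝ → ℂ} {a k : ℝ}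
    (hk : 0 < k) {g : ℂ → ℂ} (hg : IsIrrationalSeries g (logHalfPlane a k) R A) :
    ∃ K s : ℝ, 0 ≤ K ∧ 0 ≤ s ∧ ∀ (c d : ℝ), 0 ≤ c → c < d → ∀ (n : ℕ) (V : Finset ℝ),
      k * d + 2 ≤ V.card → V.card < n → ∀ L : ℝ, (∀ t ∈ Icc c d, ∀ γ ∈ V, |t - γ| ≤ L) →
      ∀ X : ℝ, d ≤ X → ∀ F : Finset ℝ, (F : Set ℝ) = R ∩ Iio X →
      ‖∑ β ∈ F, A β * (cutoff n c d β * nodal V β)‖ ≤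
        K * Real.exp (d * s) * (d - c) * ((V.card + 1).factorial *
          (((2 * (1 + (d - c)⁻¹)) ^ (2 * n) + 1) * (L + 1) ^ V.card)) := by
  obtain ⟨K, s, hK, hs, h⟩ := exists_norm_sum_mul_pow_le hR hk hg
  refine ⟨K, s, hK, hs, fun c d hc hcd n V hV hVn L hL X hX F hF => ?_⟩
  have hV0 : V.card ≠ 0 := by
    intro h0
    rw [h0] at hV
    have := mul_nonneg hk.le (hc.trans hcd.le)
    simp at hV
    linarith
  set Q := derivative^[V.card + 1] (stepPolyOn n c d * nodalPoly V) with hQ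
  have hQc : Continuous fun t : ℝ => Q.eval (t : ℂ) := Q.continuous.comp Complex.continuous_ofReal
  have hsum : ∑ β ∈ F, A β * (cutoff n c d β * nodal V β) = (-1) ^ (V.card + 1) *
      ∫ t in c..d, (∑ β ∈ F, A β * (((max (t - β) 0) ^ V.card / V.card.factorial : ℝ) : ℂ)) *
        Q.eval (t : ℂ) := by
    simp_rw [Finset.sum_mul]
    rw [intervalIntegral.integral_finsetSum, Finset.mul_sum]
    · refine Finset.sum_congr rfl fun β _ => ?_
      rw [cutoff_mul_nodal n hcd V hV0 hVn β]
      simp_rw [mul_assoc (A β)]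
      rw [intervalIntegral.integral_const_mul]
      ring
    · intro β _
      exact Continuous.intervalIntegrable (by fun_prop) _ _
  rw [hsum, norm_mul, norm_pow, norm_neg, norm_one, one_pow, one_mul]
  refine (intervalIntegral.norm_integral_le_of_norm_le_const
    (C := K * Real.exp (d * s) * ((V.card + 1).factorial *
          (((2 * (1 + (d - c)⁻¹)) ^ (2 * n) + 1) * (L + 1) ^ V.card))) fun t ht => ?_).trans ?_
  · rw [uIoc_of_le hcd.le] at ht
    have ht' : t ∈ Icc c d := ⟨ht.1.le, ht.2⟩
    have ht0 : 0 ≤ t := hc.trans ht.1.le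
    rw [norm_mul]
    refine mul_le_mul ?_ ?_ (norm_nonneg _) (by positivity)
    · refine (h t ht0 V.card ?_ X (ht.2.trans hX) F hF).trans ?_
      · nlinarith [ht.2]
      · gcongr
        exact ht.2
    · exact norm_eval_iterate_derivative_le _ _ _ _ fun ζ hζ =>
        norm_eval_stepPolyOn_mul_nodalPoly_le n hcd V L t ht' (hL t ht') ζ hζ
  · rw [abs_of_pos (sub_pos.2 hcd)]
    apply le_of_eq
    ring

/-! ### Quasi-analyticity on logarithmic half-planes. -/

theorem mem_logHalfPlane_iff {a k : ℝ} {w : ℂ} :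
    w ∈ logHalfPlane a k ↔ w.re < -k ∧ w.re + k * Real.log ‖w‖ < a := by
  have h : w.re ^ 2 + w.im ^ 2 = ‖w‖ ^ 2 := by
    rw [Complex.sq_norm, Complex.normSq_apply]; ring
  rw [logHalfPlane, mem_ofPred_eq, h, Real.log_pow]
  push_cast
  rw [show k / 2 * (2 * Real.log ‖w‖) = k * Real.log ‖w‖ by ring]

/-- Far to the left, a logarithmic half-plane stays away from the boundary `Re w = -k`. -/
theorem re_lt_of_mem_logHalfPlane {a k c : ℝ} (hk : 0 < k) {w : ℂ} (h : w ∈ logHalfPlane a k)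
    (ha : a ≤ c + k * Real.log k) : w.re < c := by
  obtain ⟨h1, h2⟩ := mem_logHalfPlane_iff.1 h
  have h3 := Complex.abs_re_le_norm w
  rw [abs_of_neg (by linarith)] at h3
  have h4 : k * Real.log k ≤ k * Real.log ‖w‖ :=
    mul_le_mul_of_nonneg_left (Real.log_le_log hk (by linarith)) hk.le
  linarith

/-- The truncations of logarithmic half-planes. -/
def truncatedLogHalfPlane (a k c X : ℝ) : Set ℂ :=
  {w | w.re < -c ∧ -X < w.re ∧ w.re + k * Real.log ‖w‖ < a}

theorem isOpen_truncatedLogHalfPlane (a k : ℝ) {c : ℝ} (hc : 0 ≤ c) (X : ℝ) :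
    IsOpen (truncatedLogHalfPlane a k c X) := by
  have h1 : IsOpen {w : ℂ | w.re < -c} := isOpen_lt Complex.continuous_re continuous_const
  have h2 : ContinuousOn (fun w : ℂ => w.re + k * Real.log ‖w‖) {w : ℂ | w.re < -c} := by
    refine Complex.continuous_re.continuousOn.add (continuousOn_const.mul
      (ContinuousOn.log (by fun_prop) fun w hw => norm_ne_zero_iff.2 ?_))
    rintro rfl
    have : (0 : ℂ).re < -c := hw
    simp at this
    linarith
  have h3 := (h2.isOpen_inter_preimage h1 (isOpen_Iio (a := a))).inter
    (isOpen_lt (continuous_const (y := -X)) Complex.continuous_re)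
  convert h3 using 1
  ext w
  simp only [truncatedLogHalfPlane, mem_ofPred_eq, mem_inter_iff, mem_preimage, mem_Iio]
  tauto

theorem closure_truncatedLogHalfPlane_subset (a k : ℝ) {c : ℝ} (hc : 0 < c) (X : ℝ) :
    closure (truncatedLogHalfPlane a k c X) ⊆
      {w | w.re ≤ -c ∧ -X ≤ w.re ∧ w.re + k * Real.log ‖w‖ ≤ a} := by
  refine closure_minimal (fun w hw => ⟨hw.1.le, hw.2.1.le, hw.2.2.le⟩) ?_
  have h1 : IsClosed {w : ℂ | w.re ≤ -c} := isClosed_le Complex.continuous_re continuous_const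
  have h2 : ContinuousOn (fun w : ℂ => w.re + k * Real.log ‖w‖) {w : ℂ | w.re ≤ -c} := by
    refine Complex.continuous_re.continuousOn.add (continuousOn_const.mul
      (ContinuousOn.log (by fun_prop) fun w hw => norm_ne_zero_iff.2 ?_))
    rintro rfl
    have : (0 : ℂ).re ≤ -c := hw
    simp at this
    linarith
  have h3 := (h2.preimage_isClosed_of_isClosed h1 (isClosed_Iic (a := a))).inter
    (isClosed_le (continuous_const (y := -X)) Complex.continuous_re)
  convert h3 using 1
  ext w
  simp only [mem_ofPred_eq, mem_inter_iff, mem_preimage, mem_Iic]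
  tauto

theorem isBounded_truncatedLogHalfPlane (a : ℝ) {k c : ℝ} (hk : 0 < k) (hc : 0 ≤ c) (X : ℝ) :
    Bornology.IsBounded (truncatedLogHalfPlane a k c X) := by
  refine (Metric.isBounded_closedBall (x := (0 : ℂ)) (r := Real.exp ((a + X) / k))).subset
    fun w hw => ?_
  rw [mem_closedBall_zero_iff]
  have hw0 : 0 < ‖w‖ := by
    have h2 := Complex.abs_re_le_norm w
    have := hw.1
    rw [abs_of_neg (by linarith)] at h2
    linarith
  rw [← Real.log_le_iff_le_exp hw0, le_div_iff₀ hk]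
  have := hw.2.1
  have := hw.2.2
  linarith

/-- Quasi-analyticity: a flat bounded holomorphic function on a logarithmic half-plane vanishes
on a smaller one. -/
theorem exists_eqOn_zero_of_flat {a k : ℝ} (hk : 0 < k) {D : ℂ → ℂ}
    (hD : DifferentiableOn ℂ D (logHalfPlane a k)) {M : ℝ} (hM : ∀ w ∈ logHalfPlane a k, ‖D w‖ ≤ M)
    (hflat : ∀ n : ℕ, ∃ C X : ℝ, ∀ w ∈ logHalfPlane a k, w.re ≤ X →
      ‖D w‖ ≤ C * Real.exp (n * w.re)) :
    ∃ a' ≤ a, ∀ w ∈ logHalfPlane a' k, D w = 0 := by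
  -- Both parameters are tightened by 1 so that the closures of the truncations stay inside the open
  -- domain of `D`.
  set a₁ := a - 1 with ha₁
  set c := k + 1 with hc
  have hc0 : 0 < c := by linarith
  set b := max c (-a₁) with hb
  set M₁ := max M 1 with hM₁
  have hcl : ∀ X, closure (truncatedLogHalfPlane a₁ k c X) ⊆ logHalfPlane a k := fun X w hw => by
    have h := closure_truncatedLogHalfPlane_subset a₁ k hc0 X hw
    exact mem_logHalfPlane_iff.2 ⟨by linarith [h.1], by linarith [h.2.2]⟩
  refine ⟨min (min a₁ (-b - 1)) (-c + k * Real.log k), ?_, fun w hw => ?_⟩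
  · refine (min_le_left _ _).trans ((min_le_left _ _).trans ?_)
    linarith
  have hwc : w.re < -c := re_lt_of_mem_logHalfPlane hk hw (min_le_right _ _)
  have hwa := (mem_logHalfPlane_iff.1 hw).2
  have hwa₁ : w.re + k * Real.log ‖w‖ < a₁ := lt_of_lt_of_le hwa
    ((min_le_left _ _).trans (min_le_left _ _))
  have hwb : w.re + k * Real.log ‖w‖ < -b - 1 := lt_of_lt_of_le hwa
    ((min_le_left _ _).trans (min_le_right _ _))
  have hnorm : ∀ z : ℂ, z.re ≤ -c → 1 ≤ ‖z‖ := fun z hz => by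
    have h2 := Complex.abs_re_le_norm z
    rw [abs_of_neg (by linarith)] at h2
    linarith
  have key : ∀ n : ℕ, ‖D w‖ ≤ M₁ * ‖w‖ * Real.exp (-(n : ℝ)) := by
    intro n
    obtain ⟨C, X₀, hC⟩ := hflat (n + 1)
    -- On the curve Re z + k log|z| = a₁ the modulus of e^{-nz} is e^{-n a₁}|z|^{kn}, and the factor
    -- z^{-p} cancels the power of |z|.
    set p := ⌈k * n⌉₊ with hp
    have hp1 : k * n ≤ p := Nat.le_ceil _
    have hp2 : (p : ℝ) < k * n + 1 := Nat.ceil_lt_add_one (by positivity)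
    set f : ℂ → ℂ := fun z => D z * (Complex.exp (-(n * z)) * (z ^ p)⁻¹) with hf
    have hfn : ∀ z, ‖f z‖ = ‖D z‖ * (Real.exp (-(n * z.re)) * (‖z‖ ^ p)⁻¹) := by
      intro z
      simp only [hf, norm_mul, norm_inv, norm_pow, Complex.norm_exp]
      simp
    obtain ⟨X, hX1, hX2, hX3⟩ : ∃ X : ℝ, -w.re < X ∧ -X₀ ≤ X ∧ |C| * Real.exp (-X) ≤ 1 := by
      have h1 : Tendsto (fun X : ℝ => |C| * Real.exp (-X)) atTop (𝓝 0) := by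
        simpa using Real.tendsto_exp_neg_atTop_nhds_zero.const_mul |C|
      exact ((eventually_gt_atTop _).and ((eventually_ge_atTop _).and
        (h1.eventually (Iic_mem_nhds one_pos)))).exists
    have hU := isOpen_truncatedLogHalfPlane a₁ k hc0.le X
    have hbd := Complex.norm_le_of_forall_mem_frontier_norm_le
      (U := truncatedLogHalfPlane a₁ k c X) (f := f) (C := M₁ * Real.exp (n * b))
      (isBounded_truncatedLogHalfPlane a₁ hk hc0.le X) (by
        refine DifferentiableOn.diffContOnCl fun z hz => ?_
        have hz0 : z ≠ 0 := by
          have := hnorm z (closure_truncatedLogHalfPlane_subset a₁ k hc0 X hz).1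
          exact norm_pos_iff.1 (by linarith)
        have h1 : DifferentiableWithinAt ℂ D (closure (truncatedLogHalfPlane a₁ k c X)) z :=
          (hD z (hcl X hz)).mono (hcl X)
        refine h1.mul (DifferentiableAt.differentiableWithinAt ?_)
        exact DifferentiableAt.mul (by fun_prop) (DifferentiableAt.inv (by fun_prop)
          (pow_ne_zero _ hz0))) (by
        intro z hz
        rw [hU.frontier_eq] at hz
        obtain ⟨hz1, hz2⟩ := hz
        obtain ⟨h1, h2, h3⟩ := closure_truncatedLogHalfPlane_subset a₁ k hc0 X hz1
        have hz1' := hcl X hz1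
        have hn1 := hnorm z h1
        have hDz := hM z hz1'
        have hinv : (‖z‖ ^ p)⁻¹ ≤ 1 := inv_le_one_of_one_le₀ (one_le_pow₀ hn1)
        have hn0 : (0 : ℝ) ≤ n := n.cast_nonneg
        have hb0 : 0 ≤ b := hc0.le.trans (le_max_left _ _)
        rw [hfn]
        -- The three parts of the frontier: on the right side, Re z = -c, `b ≥ c` suffices; on the
        -- left side, Re z = -X, flatness of order `n + 1` and the choice of `X`; on the curve, `b ≥
        -- -a₁`.
        rcases h1.eq_or_lt with h1 | h1
        · rw [h1]
          calc _ ≤ M₁ * (Real.exp (n * b) * 1) := by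
                gcongr
                · exact hDz.trans (le_max_left _ _)
                · rw [mul_neg, neg_neg]
                  exact mul_le_mul_of_nonneg_left (le_max_left _ _) hn0
            _ = _ := by rw [mul_one]
        rcases h2.eq_or_lt with h2 | h2
        · have h4 := hC z hz1' (by linarith)
          rw [← h2] at h4 ⊢
          calc _ ≤ (C * Real.exp ((n + 1 : ℕ) * -X)) * (Real.exp (-(n * -X)) * 1) := by
                gcongr
                exact (norm_nonneg _).trans h4
            _ = C * Real.exp (-X) := by
                rw [mul_one, mul_assoc, ← Real.exp_add]
                congr 2
                push_cast
                ring
            _ ≤ |C| * Real.exp (-X) := by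
                gcongr
                exact le_abs_self C
            _ ≤ 1 := hX3
            _ ≤ M₁ * Real.exp (n * b) := one_le_mul_of_one_le_of_one_le (le_max_right _ _)
                (Real.one_le_exp (by positivity))
        rcases h3.eq_or_lt with h3 | h3
        · have hl : 0 ≤ Real.log ‖z‖ := Real.log_nonneg hn1
          have h5 : Real.exp (-(n * z.re)) * (‖z‖ ^ p)⁻¹ ≤ Real.exp (n * b) := by
            rw [← Real.exp_log (by linarith : 0 < ‖z‖), ← Real.exp_nat_mul, ← Real.exp_neg,
              ← Real.exp_add]
            refine Real.exp_le_exp.2 ?_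
            have h6 : z.re = a₁ - k * Real.log ‖z‖ := by linarith
            rw [h6]
            have h7 := mul_le_mul_of_nonneg_right hp1 hl
            have h8 := mul_le_mul_of_nonneg_left (le_max_right c (-a₁)) hn0
            nlinarith
          exact mul_le_mul (hDz.trans (le_max_left _ _)) h5 (by positivity) (by positivity)
        · exact absurd ⟨h1, h2, h3⟩ hz2)
      (subset_closure (show w ∈ truncatedLogHalfPlane a₁ k c X from
        ⟨hwc, by linarith, hwa₁⟩))
    rw [hfn] at hbd
    have hw1 := hnorm w hwc.le
    have hw0 : 0 < ‖w‖ := by linarith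
    have hl : 0 ≤ Real.log ‖w‖ := Real.log_nonneg hw1
    have hpos : 0 < Real.exp (-(n * w.re)) * (‖w‖ ^ p)⁻¹ := by positivity
    -- Since `p` is less than kn + 1, dividing out leaves |w| e^{n(b + Re w + k log|w|)}; the choice
    -- of the smaller half-plane makes the bracket at most -1.
    refine le_of_mul_le_mul_right (hbd.trans ?_) hpos
    rw [mul_assoc, mul_assoc]
    refine mul_le_mul_of_nonneg_left ?_ (by positivity)
    have hwe : ‖w‖ = Real.exp (Real.log ‖w‖) := (Real.exp_log hw0).symm
    rw [hwe, ← Real.exp_nat_mul, ← Real.exp_neg, ← Real.exp_add, ← Real.exp_add, ← Real.exp_add]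
    refine Real.exp_le_exp.2 ?_
    have h7 := mul_le_mul_of_nonneg_right hp2.le hl
    have h8 := mul_le_mul_of_nonneg_left hwb.le (n.cast_nonneg : (0 : ℝ) ≤ n)
    nlinarith
  have hlim : Tendsto (fun n : ℕ => M₁ * ‖w‖ * Real.exp (-(n : ℝ))) atTop (𝓝 0) := by
    simpa using (Real.tendsto_exp_neg_atTop_nhds_zero.comp
      (tendsto_natCast_atTop_atTop (R := ℝ))).const_mul (M₁ * ‖w‖)
  have h0 : ‖D w‖ ≤ 0 := ge_of_tendsto hlim (Eventually.of_forall key)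
  exact norm_le_zero_iff.1 h0

/-! ### Windows: cut-off sums and interpolation errors. -/

/-- The order of the interpolation in the `m`-th window `[m / 2, (m + 1) / 2]`. -/
def windowOrder (k : ℝ) (m : ℕ) : ℕ := ⌈k * ((m + 1) / 2)⌉₊ + 2

/-- Equidistant interpolation nodes in the `m`-th window. -/
def windowNodes (k : ℝ) (m : ℕ) : Finset ℝ :=
  (Finset.range (windowOrder k m)).image fun j : ℕ => (m / 2 + j / (2 * windowOrder k m) : ℝ)

theorem card_windowNodes (k : ℝ) (m : ℕ) : (windowNodes k m).card = windowOrder k m := by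
  have hp : (0 : ℝ) < windowOrder k m := by
    exact_mod_cast (show 0 < windowOrder k m by simp [windowOrder])
  rw [windowNodes, Finset.card_image_of_injective, Finset.card_range]
  intro i j hij
  simp only [add_right_inj] at hij
  field_simp at hij
  exact_mod_cast hij

theorem mem_windowNodes {k : ℝ} {m : ℕ} {γ : ℝ} (h : γ ∈ windowNodes k m) :
    (m : ℝ) / 2 ≤ γ ∧ γ < (m + 1) / 2 := by
  obtain ⟨j, hj, rfl⟩ := Finset.mem_image.1 h
  have hp : (0 : ℝ) < windowOrder k m := by
    exact_mod_cast (show 0 < windowOrder k m by simp [windowOrder])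
  have hj' : (j : ℝ) < windowOrder k m := by exact_mod_cast Finset.mem_range.1 hj
  refine ⟨le_add_of_nonneg_right (by positivity), ?_⟩
  have : (j : ℝ) / (2 * windowOrder k m) < 1 / 2 := by
    rw [div_lt_div_iff₀ (by positivity) two_pos]
    linarith
  linarith

/-- This is the order needed for the cutoff that ends at (m+1)/2, hence also for the one that ends
at m/2: nodes of window `m` serve both. -/
theorem le_windowOrder (k : ℝ) (m : ℕ) : k * ((m + 1) / 2) + 2 ≤ windowOrder k m := by
  have := Nat.le_ceil (k * ((m + 1) / 2))
  rw [windowOrder]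
  push_cast
  linarith

theorem windowOrder_le {k : ℝ} (hk : 0 ≤ k) (m : ℕ) :
    (windowOrder k m : ℝ) ≤ k * ((m + 1) / 2) + 3 := by
  have := Nat.ceil_lt_add_one (show 0 ≤ k * ((m + 1) / 2) by positivity)
  rw [windowOrder]
  push_cast
  linarith

theorem windowOrder_le_succ {k : ℝ} (hk : 0 ≤ k) (m : ℕ) :
    windowOrder k m ≤ windowOrder k (m + 1) := by
  rw [windowOrder, windowOrder]
  gcongr
  simp

/-- The functional `f ↦ ∑ β ∈ R, A β * χ β * f β`, where `χ` is the cutoff function on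
`[(m - 1) / 2, m / 2]` of order `L (m + 1)`. -/
def cutSum {R : Set ℝ} (hR : IsExponentSet R) (A : ℝ → ℂ) (L m : ℕ) : (ℝ → ℂ) →ₗ[ℂ] ℂ :=
  ∑ β ∈ (hR.finite_inter_Iio (m / 2)).toFinset,
    (A β * cutoff (L * (m + 1)) ((m - 1) / 2) (m / 2) β) • LinearMap.proj β

theorem cutSum_apply {R : Set ℝ} (hR : IsExponentSet R) (A : ℝ → ℂ) {L : ℕ} (hL : 1 ≤ L) (m : ℕ)
    (f : ℝ → ℂ) {X : ℝ} (hX : (m : ℝ) / 2 ≤ X) {F : Finset ℝ} (hF : (F : Set ℝ) = R ∩ Iio X) :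
    cutSum hR A L m f =
      ∑ β ∈ F, A β * (cutoff (L * (m + 1)) ((m - 1) / 2) (m / 2) β * f β) := by
  simp only [cutSum, LinearMap.sum_apply, LinearMap.smul_apply, LinearMap.proj_apply, smul_eq_mul,
    mul_assoc]
  refine Finset.sum_subset (fun β hβ => ?_) (fun β hβ hβ' => ?_)
  · rw [Set.Finite.mem_toFinset] at hβ
    rw [← Finset.mem_coe, hF]
    exact ⟨hβ.1, lt_of_lt_of_le hβ.2 hX⟩
  · rw [Set.Finite.mem_toFinset] at hβ'
    rw [← Finset.mem_coe, hF] at hβ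
    have : (m : ℝ) / 2 ≤ β := by
      by_contra h
      exact hβ' ⟨hβ.1, not_le.1 h⟩
    rw [cutoff_of_ge (Nat.mul_pos hL (Nat.succ_pos m)) (by linarith) this]
    simp

theorem cutSum_zero {R : Set ℝ} (hR : IsExponentSet R) (A : ℝ → ℂ) (L : ℕ) (f : ℝ → ℂ) :
    cutSum hR A L 0 f = 0 := by
  have : (hR.finite_inter_Iio ((0 : ℕ) / 2)).toFinset = ∅ := by
    rw [← Finset.coe_eq_empty, Set.Finite.coe_toFinset]
    ext β
    simp only [mem_inter_iff, mem_Iio, mem_empty_iff_false, iff_false, not_and, not_lt]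
    intro h
    simpa using hR.nonneg h
  rw [cutSum, this]
  simp

theorem exists_norm_cutSum_nodal_le {R : Set ℝ} (hR : IsExponentSet R) {A : ℝ → ℂ} {a k : ℝ}
    (hk : 0 < k) {g : ℂ → ℂ} (hg : IsIrrationalSeries g (logHalfPlane a k) R A) (L : ℕ)
    (hL : 1 ≤ L) :
    ∃ K B : ℝ, 0 ≤ K ∧ 1 ≤ B ∧ ∀ (m : ℕ) (V : Finset ℝ), k * (m / 2) + 2 ≤ V.card →
      V.card < L * (m + 1) → (∀ γ ∈ V, (m - 2) / 2 ≤ γ ∧ γ ≤ ((m + 2) / 2 : ℝ)) →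
      ‖cutSum hR A L m fun x => nodal V x‖ ≤ K * B ^ m * (V.card + 1).factorial := by
  obtain ⟨K, s, hK, hs, h⟩ := exists_norm_sum_cutoff_le hR hk hg
  set B := Real.exp s * (2 * 36 ^ L * 3 ^ L) with hB
  have he1 : 1 ≤ Real.exp s := Real.one_le_exp hs
  have h36 : (1 : ℝ) ≤ 36 ^ L := one_le_pow₀ (by norm_num)
  have h3 : (1 : ℝ) ≤ 3 ^ L := one_le_pow₀ (by norm_num)
  have hB1 : 1 ≤ B := by
    rw [hB]
    refine one_le_mul_of_one_le_of_one_le he1 (one_le_mul_of_one_le_of_one_le ?_ h3)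
    linarith
  refine ⟨K * B, B, by positivity, hB1, fun m V hV hVL hVm => ?_⟩
  -- The cutoff interval of `m = 0` begins at the negative point -1/2, but no exponent lies below 0.
  rcases Nat.eq_zero_or_pos m with rfl | hm
  · rw [cutSum_zero, norm_zero]
    positivity
  have hm1 : (1 : ℝ) ≤ m := by exact_mod_cast hm
  rw [cutSum_apply hR A hL m _ le_rfl (F := (hR.finite_inter_Iio (m / 2)).toFinset) (by simp)]
  refine (h ((m - 1) / 2) (m / 2) (by linarith) (by linarith) (L * (m + 1)) V hV hVL 2
    (fun t ht γ hγ => ?_) (m / 2) le_rfl _ (by simp)).trans ?_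
  · have h1 := hVm γ hγ
    exact abs_le.2 ⟨by linarith [ht.1, h1.2], by linarith [ht.2, h1.1]⟩
  · have e1 : (m : ℝ) / 2 - (m - 1) / 2 = 1 / 2 := by ring
    have e2 : (2 : ℝ) * (1 + (1 / 2 : ℝ)⁻¹) = 6 := by norm_num
    have e3 : Real.exp (m / 2 * s) ≤ Real.exp s ^ (m + 1) := by
      rw [← Real.exp_nat_mul]
      refine Real.exp_le_exp.2 ?_
      push_cast
      nlinarith
    have e4 : (6 : ℝ) ^ (2 * (L * (m + 1))) + 1 ≤ (2 * 36 ^ L) ^ (m + 1) := by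
      have e5 : (6 : ℝ) ^ (2 * (L * (m + 1))) = (36 ^ L) ^ (m + 1) := by
        rw [pow_mul, ← pow_mul (36 : ℝ)]
        norm_num
      have e6 : (2 : ℝ) ≤ 2 ^ (m + 1) := by
        rw [pow_succ]
        linarith [one_le_pow₀ (n := m) (show (1 : ℝ) ≤ 2 by norm_num)]
      have e7 : (1 : ℝ) ≤ (36 ^ L) ^ (m + 1) := one_le_pow₀ h36
      rw [e5, mul_pow]
      nlinarith
    have e8 : ((2 : ℝ) + 1) ^ V.card ≤ (3 ^ L) ^ (m + 1) := by
      rw [← pow_mul, show (2 : ℝ) + 1 = 3 by norm_num]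
      exact pow_le_pow_right₀ (by norm_num) hVL.le
    rw [e1, e2]
    calc _ ≤ K * Real.exp s ^ (m + 1) * 1 * ((V.card + 1).factorial *
          ((2 * 36 ^ L) ^ (m + 1) * (3 ^ L) ^ (m + 1))) := by
          gcongr
          norm_num
      _ = _ := by
          rw [hB]
          ring

theorem map_stepSum (G : (ℝ → ℂ) →ₗ[ℂ] ℂ) (l : List (Finset ℝ × ℝ × ℂ)) (f : ℝ → ℂ) :
    G (fun x => stepSum l f x) = (l.map fun q =>
      q.2.2 * (divDiff q.1 f * G fun x => (nodal (q.1.erase q.2.1) x : ℂ))).sum := by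
  induction l with
  | nil =>
    simp only [stepSum, List.map_nil, List.sum_nil]
    exact map_zero G
  | cons q l ih =>
    rw [List.map_cons, List.sum_cons, ← ih, ← smul_eq_mul (divDiff _ _), ← smul_eq_mul q.2.2,
      ← map_smul, ← map_smul, ← map_add]
    congr 1

/-- The list of packages that arises when a functional is applied to a change of nodes. -/
def stepPackages (G : (ℝ → ℂ) →ₗ[ℂ] ℂ) (l : List (Finset ℝ × ℝ × ℂ)) : List (Finset ℝ × ℂ) :=
  l.map fun q => (q.1, q.2.2 * (G fun x => (nodal (q.1.erase q.2.1) x : ℂ)) /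
    ((q.1.card - 1).factorial : ℂ))

theorem sum_stepPackages (G : (ℝ → ℂ) →ₗ[ℂ] ℂ) (l : List (Finset ℝ × ℝ × ℂ)) (f : ℝ → ℂ) :
    ((stepPackages G l).map fun x => x.2 * (((x.1.card - 1).factorial : ℂ) * divDiff x.1 f)).sum =
      G (fun x => stepSum l f x) := by
  rw [map_stepSum, stepPackages, List.map_map]
  congr 1
  refine List.map_congr_left fun q _ => ?_
  have : ((q.1.card - 1).factorial : ℂ) ≠ 0 := by exact_mod_cast Nat.factorial_ne_zero _
  simp only [Function.comp]
  field_simp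

/-- The nodal polynomial has one factor fewer than the package has points, so the bound by `q.1.card
!` is divided by `(q.1.card - 1)!` and only the factor `q.1.card` survives. -/
theorem norm_stepPackages_le (G : (ℝ → ℂ) →ₗ[ℂ] ℂ) (q : Finset ℝ × ℝ × ℂ) (hq : q.2.1 ∈ q.1)
    (hε : ‖q.2.2‖ ≤ 1) {K : ℝ}
    (hG : ‖G fun x => (nodal (q.1.erase q.2.1) x : ℂ)‖ ≤
      K * ((q.1.erase q.2.1).card + 1).factorial) :
    ‖q.2.2 * (G fun x => (nodal (q.1.erase q.2.1) x : ℂ)) / ((q.1.card - 1).factorial : ℂ)‖ ≤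
      K * q.1.card := by
  have hc : 0 < q.1.card := Finset.card_pos.2 ⟨_, hq⟩
  rw [Finset.card_erase_of_mem hq, show q.1.card - 1 + 1 = q.1.card by lia,
    ← Nat.mul_factorial_pred hc.ne'] at hG
  have hf : (0 : ℝ) < (q.1.card - 1).factorial := by exact_mod_cast Nat.factorial_pos _
  rw [norm_div, norm_mul, Complex.norm_natCast, div_le_iff₀ hf]
  push_cast at hG
  calc _ ≤ 1 * (K * (q.1.card * (q.1.card - 1).factorial)) := by gcongr
    _ = _ := by ring

theorem HasLinearDensity.nonneg {R : Set ℝ} {μ ν : ℝ} (h : HasLinearDensity R μ ν) : 0 ≤ μ := by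
  by_contra hμ
  push Not at hμ
  have h1 := h (|ν| / -μ) (div_nonneg (abs_nonneg _) (by linarith))
  have h2 : μ * (|ν| / -μ + 1) = -|ν| + μ := by
    have := hμ.ne
    field_simp
  rw [h2] at h1
  have h3 : (0 : ℝ) ≤ ((R ∩ Icc (|ν| / -μ) (|ν| / -μ + 1)).ncard : ℝ) := Nat.cast_nonneg _
  linarith [le_abs_self ν]

/-- The error of interpolation at the nodes of the `m`-th window, as a functional. -/
def cutError {R : Set ℝ} (hR : IsExponentSet R) (A : ℝ → ℂ) (k : ℝ) (L m : ℕ) (f : ℝ → ℂ) : ℂ :=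
  cutSum hR A L m (fun x => f x - interp (windowNodes k m) f x)

/-- The increment separates into a change of cutoff with fixed nodes and a change of nodes with
fixed cutoff. -/
theorem cutError_succ_sub {R : Set ℝ} (hR : IsExponentSet R) (A : ℝ → ℂ) (k : ℝ) (L m : ℕ)
    (f : ℝ → ℂ) : cutError hR A k L (m + 1) f - cutError hR A k L m f =
      (cutSum hR A L (m + 1) - cutSum hR A L m) (fun x => f x - interp (windowNodes k m) f x) +
      (-cutSum hR A L (m + 1)) (fun x => interp (windowNodes k (m + 1)) f x -
        interp (windowNodes k m) f x) := by
  have h : (fun x => f x - interp (windowNodes k (m + 1)) f x) =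
      (fun x => f x - interp (windowNodes k m) f x) - fun x =>
        interp (windowNodes k (m + 1)) f x - interp (windowNodes k m) f x := by
    ext x
    simp
  rw [cutError, cutError, h, map_sub, LinearMap.sub_apply, LinearMap.neg_apply]
  ring

/-- Consecutive cutoffs are both 1 to the left of this window and both 0 to its right. -/
theorem cutSum_sub_congr {R : Set ℝ} (hR : IsExponentSet R) (A : ℝ → ℂ) {L : ℕ} (hL : 1 ≤ L)
    (m : ℕ) {f f' : ℝ → ℂ}
    (h : ∀ β ∈ R, (m - 1) / 2 ≤ β → β < (m + 1 : ℝ) / 2 → f β = f' β) :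
    (cutSum hR A L (m + 1) - cutSum hR A L m) f = (cutSum hR A L (m + 1) - cutSum hR A L m) f' := by
  have hF : ((hR.finite_inter_Iio ((m + 1 : ℕ) / 2)).toFinset : Set ℝ) =
    R ∩ Iio ((m + 1 : ℕ) / 2) := by simp
  simp only [LinearMap.sub_apply]
  rw [cutSum_apply hR A hL (m + 1) f le_rfl hF, cutSum_apply hR A hL (m + 1) f' le_rfl hF,
    cutSum_apply hR A hL m f (by push_cast; linarith) hF,
    cutSum_apply hR A hL m f' (by push_cast; linarith) hF, ← Finset.sum_sub_distrib,
    ← Finset.sum_sub_distrib]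
  refine Finset.sum_congr rfl fun β hβ => ?_
  rw [Set.Finite.mem_toFinset] at hβ
  by_cases h1 : (m - 1 : ℝ) / 2 ≤ β
  · rw [h β hβ.1 h1 (by have := hβ.2; simpa using this)]
  · push Not at h1
    rw [cutoff_of_le (by push_cast; linarith), cutoff_of_le h1.le]
    ring

theorem card_window_le {R : Set ℝ} (hR : IsExponentSet R) {μ ν : ℝ} (h : HasLinearDensity R μ ν)
    (m : ℕ) (E : Finset ℝ) (hE : ∀ β ∈ E, β ∈ R ∧ (m - 1 : ℝ) / 2 ≤ β ∧ β < (m + 1) / 2) :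
    (E.card : ℝ) ≤ μ * (m / 2 + 1) + ν := by
  set x := max ((m - 1 : ℝ) / 2) 0 with hx
  have h1 := h x (le_max_right _ _)
  have hfin : (R ∩ Icc x (x + 1)).Finite := (hR.finite_inter_Iio (x + 2)).subset fun y hy =>
    ⟨hy.1, by have := hy.2.2; simp only [mem_Iio]; linarith⟩
  have h2 : E.card ≤ (R ∩ Icc x (x + 1)).ncard := by
    rw [← Set.ncard_coe_finset]
    refine Set.ncard_le_ncard (fun β hβ => ?_) hfin
    obtain ⟨h3, h4, h5⟩ := hE β hβ
    refine ⟨h3, max_le h4 (hR.nonneg h3), ?_⟩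
    have := le_max_left ((m - 1 : ℝ) / 2) 0
    linarith
  have h3 : x ≤ m / 2 := max_le (by linarith) (by positivity)
  have h4 : (E.card : ℝ) ≤ (R ∩ Icc x (x + 1)).ncard := by exact_mod_cast h2
  have := mul_le_mul_of_nonneg_left h3 h.nonneg
  linarith

set_option maxHeartbeats 1000000 in
/-- The increments of the interpolation errors decompose into few Vandermonde packages with
coefficients of at most exponential growth. -/
theorem exists_window_packages {R : Set ℝ} (hR : IsExponentSet R) {A : ℝ → ℂ} {a k : ℝ}
    (hk : 0 < k) {g : ℂ → ℂ} (hg : IsIrrationalSeries g (logHalfPlane a k) R A) {μ ν : ℝ}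
    (hdens : HasLinearDensity R μ ν) :
    ∃ (L : ℕ) (K B c : ℝ), 1 ≤ L ∧ 0 ≤ K ∧ 1 ≤ B ∧ ∀ m : ℕ, ∃ l : List (Finset ℝ × ℂ),
      l ≠ [] ∧ (l.length : ℝ) ≤ 3 * L * (m + 1) ∧
      (∀ x ∈ l, x.1.Nonempty ∧ (∀ γ ∈ x.1, 0 ≤ γ ∧ (m - 1 : ℝ) / 2 ≤ γ ∧ γ ≤ (m + 2) / 2) ∧
        (x.1.card - 1 : ℝ) ≤ (μ + k) * ((m - 1) / 2) + c ∧ ‖x.2‖ ≤ K * (m + 1) * B ^ m) ∧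
      (∀ β ∈ R, (m - 1 : ℝ) / 2 ≤ β → β < (m + 1) / 2 → ∃ x ∈ l, β ∈ x.1) ∧
      ∀ f, (l.map fun x => x.2 * (((x.1.card - 1).factorial : ℂ) * divDiff x.1 f)).sum =
        cutError hR A k L (m + 1) f - cutError hR A k L m f := by
  have hμ := hdens.nonneg
  -- With this `L` every node set that occurs has at most L(m+1) points, so its nodal polynomials
  -- have degree below the order of the cutoffs.
  set L := ⌈k + μ + |ν| + 3⌉₊ + 1 with hLdef
  have hL : 1 ≤ L := by lia
  have hLr : k + μ + |ν| + 4 ≤ L := by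
    rw [hLdef]
    push_cast
    linarith [Nat.le_ceil (k + μ + |ν| + 3)]
  have hν := abs_nonneg ν
  obtain ⟨K, B, hK, hB, hbound⟩ := exists_norm_cutSum_nodal_le hR hk hg L hL
  refine ⟨L, 2 * K * B * L, B, 2 * k + 2 * μ + |ν| + 5, hL, by positivity, hB, fun m => ?_⟩
  have hm0 : (0 : ℝ) ≤ m := m.cast_nonneg
  have hkm : 0 ≤ k * m := by positivity
  have hμm : 0 ≤ μ * m := by positivity
  set Γ := windowNodes k m with hΓ
  set Γ' := windowNodes k (m + 1) with hΓ'
  have hΓc : Γ.card = windowOrder k m := card_windowNodes k m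
  have hΓ'c : Γ'.card = windowOrder k (m + 1) := card_windowNodes k (m + 1)
  have hp1 := le_windowOrder k m
  have hp2 := windowOrder_le hk.le m
  have hp3 := windowOrder_le hk.le (m + 1)
  push_cast at hp3
  have hfin : (R ∩ Ico ((m - 1 : ℝ) / 2) ((m + 1) / 2)).Finite :=
    (hR.finite_inter_Iio ((m + 1) / 2)).subset fun y hy => ⟨hy.1, hy.2.2⟩
  -- The functional in the change of cutoff sees only exponents of the window. On them `f` equals
  -- its interpolant at `Γ ∪ E`, so `f - interp Γ f` is an insertion path.
  set E := hfin.toFinset \ Γ with hE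
  have hEmem : ∀ β ∈ E, β ∈ R ∧ (m - 1 : ℝ) / 2 ≤ β ∧ β < (m + 1) / 2 := by
    intro β hβ
    rw [hE, Finset.mem_sdiff, Set.Finite.mem_toFinset] at hβ
    exact hβ.1
  have hEc := card_window_le hR hdens m E hEmem
  have hRE : ∀ β ∈ R, (m - 1 : ℝ) / 2 ≤ β → β < (m + 1) / 2 → β ∈ Γ ∪ E := by
    intro β h1 h2 h3
    by_cases h : β ∈ Γ
    · exact Finset.mem_union_left _ h
    · refine Finset.mem_union_right _ (Finset.mem_sdiff.2 ⟨?_, h⟩)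
      rw [Set.Finite.mem_toFinset]
      exact ⟨h1, h2, h3⟩
  have hsum : (Γ.card : ℝ) + E.card ≤ (L - 1) * (m + 1) := by
    rw [hΓc]
    have h1 : ν ≤ |ν| := le_abs_self ν
    have h2 := mul_nonneg hν hm0
    have h3 : (k + μ + |ν| + 3) * (m + 1) ≤ (L - 1 : ℝ) * (m + 1) := by
      gcongr
      linarith
    nlinarith
  have hΓ'L : (Γ'.card : ℝ) ≤ (L - 1) * (m + 1) := by
    rw [hΓ'c]
    have h2 := mul_nonneg hν hm0
    have h3 : (k + μ + |ν| + 3) * (m + 1) ≤ (L - 1 : ℝ) * (m + 1) := by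
      gcongr
      linarith
    nlinarith
  have hdisj : Disjoint Γ E := Finset.disjoint_sdiff
  obtain ⟨l₁, hl₁, hq₁, hlast₁, hs₁⟩ := exists_insertion_path Γ E hdisj
  obtain ⟨l₂, hl₂, hq₂, hfirst₂, hs₂⟩ := exists_exchange_path Γ' (Γ' \ Γ).card Γ rfl
    (by rw [hΓc, hΓ'c]; exact windowOrder_le_succ hk.le m)
  have hΓne : Γ ≠ Γ' := by
    intro h
    obtain ⟨γ, hγ⟩ : Γ.Nonempty := Finset.card_pos.1 (by rw [hΓc]; simp [windowOrder])
    have h1 := (mem_windowNodes hγ).2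
    rw [h] at hγ
    have h2 := (mem_windowNodes hγ).1
    push_cast at h2
    linarith
  have hΓmem : ∀ γ ∈ Γ, 0 ≤ γ ∧ (m - 1 : ℝ) / 2 ≤ γ ∧ γ ≤ (m + 1) / 2 := fun γ hγ => by
    have h1 := mem_windowNodes hγ
    exact ⟨by linarith, by linarith, h1.2.le⟩
  have hmem₁ : ∀ γ ∈ Γ ∪ E, 0 ≤ γ ∧ (m - 1 : ℝ) / 2 ≤ γ ∧ γ ≤ (m + 1) / 2 := fun γ hγ => by
    rcases Finset.mem_union.1 hγ with h | h
    · exact hΓmem γ h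
    · obtain ⟨h1, h2, h3⟩ := hEmem γ h
      exact ⟨hR.nonneg h1, h2, h3.le⟩
  have hmem₂ : ∀ γ ∈ Γ ∪ Γ', (m : ℝ) / 2 ≤ γ ∧ γ ≤ (m + 2) / 2 := fun γ hγ => by
    rcases Finset.mem_union.1 hγ with h | h
    · have h1 := mem_windowNodes h
      exact ⟨h1.1, by linarith⟩
    · have h1 := mem_windowNodes h
      push_cast at h1
      exact ⟨by linarith, by linarith⟩
  have hBm : B ^ m ≤ B ^ (m + 1) := pow_le_pow_right₀ hB (by lia)
  -- bounds for one package
  have hfinal : ∀ (x : ℝ) (n : ℕ), x ≤ K * B ^ m + K * B ^ (m + 1) → (n : ℝ) ≤ L * (m + 1) →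
      x * n ≤ 2 * K * B * L * (m + 1) * B ^ m := by
    intro x n hx hn
    have h1 : x ≤ 2 * K * B ^ (m + 1) := by
      have := mul_le_mul_of_nonneg_left hBm hK
      linarith
    calc x * n ≤ (2 * K * B ^ (m + 1)) * (L * (m + 1)) := by gcongr
      _ = _ := by ring
  -- Insertions contribute about (μ+k)m/2 points to a package, k from `Γ` and μ from `E`; exchanges
  -- contribute only about km/2. Nodes outside `R` also enter, and this is why `R'` is larger than
  -- `R`.
  set l := stepPackages (cutSum hR A L (m + 1) - cutSum hR A L m) l₁ ++
    stepPackages (-cutSum hR A L (m + 1)) l₂ with hl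
  have hfst₂ : ∃ x ∈ l, Γ ⊆ x.1 := by
    obtain ⟨q, hq, hqΓ⟩ := hfirst₂ hΓne
    exact ⟨_, List.mem_append_right _ (List.mem_map_of_mem hq), hqΓ⟩
  refine ⟨l, ?_, ?_, ?_, ?_, ?_⟩
  · rintro h
    obtain ⟨x, hx, -⟩ := hfst₂
    rw [h] at hx
    simp at hx
  · have h1 : l.length ≤ E.card + 2 * Γ'.card := by
      rw [hl, List.length_append, stepPackages, stepPackages, List.length_map, List.length_map, hl₁]
      have : (Γ' \ Γ).card ≤ Γ'.card := Finset.card_le_card Finset.sdiff_subset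
      lia
    have h2 : (l.length : ℝ) ≤ E.card + 2 * Γ'.card := by exact_mod_cast h1
    have h3 : (0 : ℝ) ≤ Γ.card := Nat.cast_nonneg _
    nlinarith
  · intro x hx
    rcases List.mem_append.1 hx with hx | hx
    · obtain ⟨q, hq, rfl⟩ := List.mem_map.1 hx
      obtain ⟨h1, h2, h3, h4⟩ := hq₁ q hq
      have hcard : q.1.card ≤ Γ.card + E.card :=
        (Finset.card_le_card h3).trans (Finset.card_union_le _ _)
      have hcardr : (q.1.card : ℝ) ≤ Γ.card + E.card := by exact_mod_cast hcard
      have hcL : (q.1.card : ℝ) ≤ (L - 1) * (m + 1) := hcardr.trans hsum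
      have hcL' : (q.1.card : ℝ) ≤ L * (m + 1) := by linarith
      have hcN : q.1.card ≤ L * (m + 1) := by exact_mod_cast hcL'
      have hcN' : L * (m + 1) ≤ L * (m + 1 + 1) := Nat.mul_le_mul_left L (by lia)
      have hne : 0 < q.1.card := Finset.card_pos.2 ⟨_, h1⟩
      have hce : (q.1.erase q.2.1).card = q.1.card - 1 := Finset.card_erase_of_mem h1
      have hlow : k * ((m + 1) / 2) + 2 ≤ ((q.1.erase q.2.1).card : ℝ) := by
        rw [hce]
        refine hp1.trans ?_
        rw [← hΓc]
        exact_mod_cast (by lia : Γ.card ≤ q.1.card - 1)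
      have hVm : ∀ γ ∈ q.1.erase q.2.1, (m - 1 : ℝ) / 2 ≤ γ ∧ γ ≤ (m + 1) / 2 := fun γ hγ =>
        (hmem₁ γ (h3 (Finset.mem_of_mem_erase hγ))).2
      refine ⟨⟨_, h1⟩, fun γ hγ => ?_, ?_, ?_⟩
      · obtain ⟨h5, h6, h7⟩ := hmem₁ γ (h3 hγ)
        exact ⟨h5, h6, by linarith⟩
      · rw [hΓc] at hcardr
        linarith [le_abs_self ν]
      · have b1 := hbound (m + 1) (q.1.erase q.2.1) (by push_cast; exact hlow)
          (by rw [hce]; exact lt_of_lt_of_le (by lia) hcN') (fun γ hγ => by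
            have := hVm γ hγ
            push_cast
            exact ⟨by linarith, by linarith⟩)
        have b2 := hbound m (q.1.erase q.2.1) (by linarith)
          (by rw [hce]; lia) (fun γ hγ => by
            have := hVm γ hγ
            exact ⟨by linarith, by linarith⟩)
        refine (norm_stepPackages_le _ q h1 h2 (K := K * B ^ (m + 1) + K * B ^ m) ?_).trans
          (hfinal _ _ (add_comm _ _).le hcL')
        rw [LinearMap.sub_apply, add_mul]
        exact (norm_sub_le _ _).trans (add_le_add b1 b2)
    · obtain ⟨q, hq, rfl⟩ := List.mem_map.1 hx
      obtain ⟨h1, h2, h3, h4, h5⟩ := hq₂ q hq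
      have hcardr : (q.1.card : ℝ) ≤ Γ'.card + 1 := by exact_mod_cast h5
      have hcL' : (q.1.card : ℝ) ≤ L * (m + 1) := by linarith
      have hcN : q.1.card ≤ L * (m + 1) := by exact_mod_cast hcL'
      have hcN' : L * (m + 1) ≤ L * (m + 1 + 1) := Nat.mul_le_mul_left L (by lia)
      have hne : 0 < q.1.card := Finset.card_pos.2 ⟨_, h1⟩
      have hce : (q.1.erase q.2.1).card = q.1.card - 1 := Finset.card_erase_of_mem h1
      have hlow : k * ((m + 1) / 2) + 2 ≤ ((q.1.erase q.2.1).card : ℝ) := by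
        rw [hce]
        refine hp1.trans ?_
        rw [← hΓc]
        exact_mod_cast (by lia : Γ.card ≤ q.1.card - 1)
      refine ⟨⟨_, h1⟩, fun γ hγ => ?_, ?_, ?_⟩
      · have := hmem₂ γ (h3 hγ)
        exact ⟨by linarith, by linarith, this.2⟩
      · rw [hΓ'c] at hcardr
        linarith
      · have b1 := hbound (m + 1) (q.1.erase q.2.1) (by push_cast; exact hlow)
          (by rw [hce]; exact lt_of_lt_of_le (by lia) hcN') (fun γ hγ => by
            have := hmem₂ γ (h3 (Finset.mem_of_mem_erase hγ))
            push_cast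
            exact ⟨by linarith, by linarith⟩)
        refine (norm_stepPackages_le _ q h1 h2 (K := K * B ^ (m + 1)) ?_).trans
          (hfinal _ _ (le_add_of_nonneg_left (by positivity)) hcL')
        rw [LinearMap.neg_apply, norm_neg]
        exact b1
  · intro β h1 h2 h3
    by_cases hEe : E.Nonempty
    · obtain ⟨q, hq, hqE⟩ := hlast₁ hEe
      refine ⟨_, List.mem_append_left _ (List.mem_map_of_mem hq), ?_⟩
      simp only [hqE]
      exact hRE β h1 h2 h3
    -- If there is nothing to insert, the exponents of the window lie in `Γ`, which is contained in
    -- the first package of the exchange.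
    · obtain ⟨x, hx, hxΓ⟩ := hfst₂
      refine ⟨x, hx, hxΓ ?_⟩
      have := hRE β h1 h2 h3
      rwa [Finset.not_nonempty_iff_eq_empty.1 hEe, Finset.union_empty] at this
  · intro f
    rw [hl, List.map_append, List.sum_append, sum_stepPackages, sum_stepPackages,
      cutError_succ_sub]
    congr 1
    · refine cutSum_sub_congr hR A hL m fun β h1 h2 h3 => ?_
      rw [← hs₁, interp_of_mem (hRE β h1 h2 h3)]
    · congr 1
      ext x
      rw [← hs₂]

/-! ### Comparison with the formal series and convergence of the packages. -/

theorem cutError_zero {R : Set ℝ} (hR : IsExponentSet R) (A : ℝ → ℂ) (k : ℝ) (L : ℕ) (f : ℝ → ℂ) :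
    cutError hR A k L 0 f = 0 := cutSum_zero hR A L _

/-- Up to contributions of exponents that are at least `X`, the functional `cutError` is the formal
series itself. -/
theorem exists_norm_cutError_sub_le {R : Set ℝ} (hR : IsExponentSet R) (A : ℝ → ℂ) (k : ℝ) {L : ℕ}
    (hL : 1 ≤ L) (m : ℕ) {X : ℝ} (hX : X ≤ (m - 1) / 2) (F : Finset ℝ)
    (hF : (F : Set ℝ) = R ∩ Iio X) :
    ∃ C : ℝ, 0 ≤ C ∧ ∀ (f : ℝ → ℂ) (δ : ℝ), (∀ t, X ≤ t → ‖f t‖ ≤ δ) →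
      ‖cutError hR A k L m f - ∑ β ∈ F, A β * f β‖ ≤ C * δ := by
  set E := (hR.finite_inter_Iio (m / 2)).toFinset with hE
  set χ : ℝ → ℂ := fun β => A β * cutoff (L * (m + 1)) ((m - 1) / 2) (m / 2) β with hχ
  set ℓ : ℝ → ℝ → ℂ := fun β γ =>
    ((∏ δ ∈ (windowNodes k m).erase γ, (β - δ) * (γ - δ)⁻¹ : ℝ) : ℂ) with hℓ
  refine ⟨∑ β ∈ E, ‖χ β‖ * (1 + ∑ γ ∈ windowNodes k m, ‖ℓ β γ‖), by positivity,
    fun f δ hδ => ?_⟩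
  have hδ0 : 0 ≤ δ := (norm_nonneg _).trans (hδ X le_rfl)
  have hsum : ∑ β ∈ F, A β * f β = ∑ β ∈ E, if β < X then A β * f β else 0 := by
    rw [← Finset.sum_filter]
    congr 1
    ext β
    rw [Finset.mem_filter, ← Finset.mem_coe, hF, hE, Set.Finite.mem_toFinset]
    simp only [mem_inter_iff, mem_Iio]
    constructor
    · rintro ⟨h1, h2⟩
      exact ⟨⟨h1, by linarith⟩, h2⟩
    · rintro ⟨⟨h1, -⟩, h2⟩
      exact ⟨h1, h2⟩
  have hcut : cutError hR A k L m f = ∑ β ∈ E, χ β * (f β - interp (windowNodes k m) f β) := by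
    rw [cutError, cutSum_apply hR A hL m _ le_rfl (F := E) (by simp [hE])]
    exact Finset.sum_congr rfl fun β _ => (mul_assoc _ _ _).symm
  rw [hsum, hcut, ← Finset.sum_sub_distrib, Finset.sum_mul]
  refine norm_sum_le_of_le _ fun β _ => ?_
  -- The nodes lie beyond the cut, hence beyond `X`, so the interpolant sees only values bounded by
  -- `δ`.
  have hint : ‖interp (windowNodes k m) f β‖ ≤ (∑ γ ∈ windowNodes k m, ‖ℓ β γ‖) * δ := by
    rw [interp, Finset.sum_mul]
    refine norm_sum_le_of_le _ fun γ hγ => ?_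
    rw [norm_mul]
    refine mul_le_mul_of_nonneg_left (hδ γ ?_) (norm_nonneg _)
    linarith [(mem_windowNodes hγ).1]
  have hrest : ‖χ β * f β - if β < X then A β * f β else 0‖ ≤ ‖χ β‖ * δ := by
    split_ifs with h
    · simp only [hχ]
      rw [cutoff_of_le (by linarith)]
      simp only [mul_one, sub_self, norm_zero]
      positivity
    · rw [sub_zero, norm_mul]
      exact mul_le_mul_of_nonneg_left (hδ β (not_lt.1 h)) (norm_nonneg _)
  calc _ = ‖(χ β * f β - if β < X then A β * f β else 0) -
        χ β * interp (windowNodes k m) f β‖ := by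
        congr 1
        ring
    _ ≤ ‖χ β‖ * δ + ‖χ β‖ * ((∑ γ ∈ windowNodes k m, ‖ℓ β γ‖) * δ) := by
        refine (norm_sub_le _ _).trans (add_le_add hrest ?_)
        rw [norm_mul]
        gcongr
    _ = _ := by ring

theorem isExponentSet_iUnion {ι : Type*} (S : ι → Finset ℝ) (h0 : ∀ i, ∀ γ ∈ S i, 0 ≤ γ)
    (hfin : ∀ Y : ℝ, {i | ∃ γ ∈ S i, γ ≤ Y}.Finite) : IsExponentSet (⋃ i, (S i : Set ℝ)) := by
  set R := ⋃ i, (S i : Set ℝ) with hR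
  have hRfin : ∀ Y, (R ∩ Iic Y).Finite := by
    intro Y
    refine ((hfin Y).biUnion fun i _ => (S i).finite_toSet).subset ?_
    rintro γ ⟨hγ, hγY⟩
    obtain ⟨i, hi⟩ := mem_iUnion.1 hγ
    exact mem_biUnion (show i ∈ {i | ∃ γ ∈ S i, γ ≤ Y} from ⟨γ, hi, hγY⟩) hi
  have h : IsClosed R ∧ IsDiscrete R := by
    rw [isClosed_and_discrete_iff]
    intro x
    rw [Filter.disjoint_principal_right]
    have h1 : ((R ∩ Iic (x + 1)) \ {x})ᶜ ∈ 𝓝 x :=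
      ((hRfin (x + 1)).subset sdiff_subset).isClosed.isOpen_compl.mem_nhds (by simp)
    have h2 : Iio (x + 1) ∈ 𝓝 x := Iio_mem_nhds (by linarith)
    filter_upwards [mem_nhdsWithin_of_mem_nhds h1, mem_nhdsWithin_of_mem_nhds h2,
      self_mem_nhdsWithin] with y hy1 hy2 hy3 hyR
    exact hy1 ⟨⟨hyR, mem_Iic.2 (le_of_lt (mem_Iio.1 hy2))⟩, hy3⟩
  refine ⟨h.1, h.2, fun γ hγ => ?_⟩
  obtain ⟨i, hi⟩ := mem_iUnion.1 hγ
  exact h0 i γ hi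

/-- The part e^{X Re w} of e^{β Re w} is set aside for flatness; the remaining β - X still pays for
|w|^N, because |w|^κ e^{Re w} ≤ e^a. -/
theorem norm_vandermondePackage_le_exp (S : Finset ℝ) (β : ℝ) (hβ : IsLeast (S : Set ℝ) β)
    {κ a X : ℝ} (hκ : 0 < κ) (hN : (S.card - 1 : ℝ) ≤ κ * (β - X)) (w : ℂ) (hw : 1 ≤ ‖w‖)
    (hre : w.re ≤ 0) (ha : w.re + κ * Real.log ‖w‖ ≤ a) :
    ‖vandermondePackage S w‖ ≤ Real.exp (X * w.re) * Real.exp ((β - X) * a) := by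
  have hc : 0 < S.card := Finset.card_pos.2 ⟨β, hβ.1⟩
  obtain ⟨n, hn⟩ : ∃ n, S.card = n + 1 := ⟨S.card - 1, by lia⟩
  rw [hn] at hN
  push_cast at hN
  rw [add_sub_cancel_right] at hN
  have hβX : 0 ≤ β - X := by
    have h1 : 0 ≤ κ * (β - X) := le_trans n.cast_nonneg hN
    exact nonneg_of_mul_nonneg_right h1 hκ
  refine (norm_vandermondePackage_le S n hn β hβ w hre).trans ?_
  have hl : 0 ≤ Real.log ‖w‖ := Real.log_nonneg hw
  rw [← Real.exp_log (by linarith : 0 < ‖w‖), ← Real.exp_nat_mul, ← Real.exp_add, ← Real.exp_add]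
  refine Real.exp_le_exp.2 ?_
  have h1 := mul_le_mul_of_nonneg_right hN hl
  have h2 := mul_le_mul_of_nonneg_left ha hβX
  nlinarith

/-- A crude bound for the finitely many packages whose β is too small for the exponential estimate.
-/
theorem norm_vandermondePackage_le_sum (S : Finset ℝ) (hS : ∀ γ ∈ S, 0 ≤ γ) (w : ℂ)
    (hre : w.re ≤ 0) :
    ‖vandermondePackage S w‖ ≤ ∑ γ ∈ S, |normalizedVandermondeCoeff S γ| := by
  refine norm_sum_le_of_le _ fun γ hγ => ?_
  rw [norm_mul, Complex.norm_real, Complex.norm_exp, Complex.re_ofReal_mul, Real.norm_eq_abs]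
  exact mul_le_of_le_one_right (abs_nonneg _)
    (Real.exp_le_one_iff.2 (mul_nonpos_of_nonneg_of_nonpos (hS γ hγ) hre))

theorem differentiable_vandermondePackage (S : Finset ℝ) :
    Differentiable ℂ (vandermondePackage S) := by
  unfold vandermondePackage package
  fun_prop

theorem summable_sigma_fin (n : ℕ → ℕ) (f : (Σ m, Fin (n m)) → ℝ) {C₁ C₂ : ℝ} (hC₂ : 0 ≤ C₂)
    (hn : ∀ m, (n m : ℝ) ≤ C₁ * (m + 1)) (h0 : ∀ i, 0 ≤ f i)
    (hf : ∀ i, f i ≤ C₂ * (i.1 + 1) * (1 / 8) ^ i.1) : Summable f := by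
  have hC₁ : 0 ≤ C₁ := by
    have := hn 0
    simp only [CharP.cast_eq_zero, zero_add, mul_one] at this
    exact le_trans (Nat.cast_nonneg _) this
  rw [summable_sigma_of_nonneg h0]
  refine ⟨fun m => Summable.of_finite, ?_⟩
  refine Summable.of_nonneg_of_le (fun m => tsum_nonneg fun _ => h0 _) (fun m => ?_)
    ((summable_geometric_of_lt_one (r := 1 / 2) (by norm_num) (by norm_num)).mul_left (C₁ * C₂))
  rw [tsum_fintype]
  refine (Finset.sum_le_card_nsmul _ _ (C₂ * (m + 1) * (1 / 8) ^ m) fun j _ => hf ⟨m, j⟩).trans ?_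
  rw [Finset.card_univ, Fintype.card_fin, nsmul_eq_mul]
  have h2 : (m : ℝ) + 1 ≤ 2 ^ m := by exact_mod_cast Nat.lt_two_pow_self (n := m)
  calc _ ≤ (C₁ * 2 ^ m) * (C₂ * 2 ^ m * (1 / 8) ^ m) := by
        gcongr
        exact (hn m).trans (mul_le_mul_of_nonneg_left h2 hC₁)
    _ = C₁ * C₂ * (2 * 2 * (1 / 8)) ^ m := by
        rw [mul_pow, mul_pow]
        ring
    _ = _ := by norm_num

theorem finite_sigma_fin (n : ℕ → ℕ) (M : ℕ) : {i : Σ m, Fin (n m) | i.1 < M}.Finite := by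
  refine ((Finset.range M).sigma fun m => (Finset.univ : Finset (Fin (n m)))).finite_toSet.subset
    fun i hi => ?_
  simpa using hi

/-- The decomposition into packages, indexed by windows and positions in a window. -/
theorem exists_package_family (R : Set ℝ) (hR : IsExponentSet R) (A : ℝ → ℂ) (a k : ℝ) (hk : 0 < k)
    (g : ℂ → ℂ) (hg : IsIrrationalSeries g (logHalfPlane a k) R A)
    (μ ν : ℝ) (hdens : HasLinearDensity R μ ν) :
    ∃ (n : ℕ → ℕ) (S : (Σ m, Fin (n m)) → Finset ℝ) (β : (Σ m, Fin (n m)) → ℝ)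
      (b : (Σ m, Fin (n m)) → ℂ) (v : (Σ m, Fin (n m)) → ℝ) (r c a' : ℝ),
      (∀ m, 0 < n m) ∧
      (∀ i, IsLeast (S i : Set ℝ) (β i)) ∧ (∀ i, ∀ γ ∈ S i, 0 ≤ γ) ∧
      (∀ Y : ℝ, {i | ∃ γ ∈ S i, γ ≤ Y}.Finite) ∧
      R ⊆ ⋃ i, (S i : Set ℝ) ∧
      0 < r ∧ r < 1 ∧ Summable (fun i => ‖b i‖ * r ^ β i) ∧
      (∀ i, ((S i).card - 1 : ℝ) ≤ (μ + 2 * k) * β i + c) ∧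
      logHalfPlane a' (μ + 2 * k) ⊆ logHalfPlane a k ∧
      (∀ γ : ℝ, HasSum (fun i => (S i : Set ℝ).indicator
        (fun γ => b i * (normalizedVandermondeCoeff (S i) γ : ℂ)) γ) (R.indicator A γ)) ∧
      Summable v ∧
      (∀ w ∈ logHalfPlane a' (μ + 2 * k), ∀ i, ‖b i * vandermondePackage (S i) w‖ ≤ v i) ∧
      (∀ w ∈ logHalfPlane a' (μ + 2 * k),
        HasSum (fun i => b i * vandermondePackage (S i) w) (g w)) := by
  obtain ⟨L, K, B, c₀, hL, hK, hB, hwin⟩ := exists_window_packages hR hk hg hdens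
  have hμ := hdens.nonneg
  choose l hlne hllen hlx hlcov hlsum using hwin
  set c := |c₀| with hcdef
  have hc0 : 0 ≤ c := abs_nonneg _
  set n : ℕ → ℕ := fun m => (l m).length with hn
  set S : (Σ m, Fin (n m)) → Finset ℝ := fun i => ((l i.1).get i.2).1 with hS
  set b : (Σ m, Fin (n m)) → ℂ := fun i => ((l i.1).get i.2).2 with hb
  have hmem : ∀ i : Σ m, Fin (n m), (l i.1).get i.2 ∈ l i.1 := fun i => List.get_mem _ _
  have hne : ∀ i, (S i).Nonempty := fun i => (hlx i.1 _ (hmem i)).1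
  set β : (Σ m, Fin (n m)) → ℝ := fun i => (S i).min' (hne i) with hβdef
  have hβ : ∀ i, IsLeast (S i : Set ℝ) (β i) := fun i => Finset.isLeast_min' _ _
  have hSpos : ∀ i, ∀ γ ∈ S i, 0 ≤ γ := fun i γ hγ => ((hlx i.1 _ (hmem i)).2.1 γ hγ).1
  have hSlow : ∀ i, ∀ γ ∈ S i, ((i.1 : ℝ) - 1) / 2 ≤ γ := fun i γ hγ =>
    ((hlx i.1 _ (hmem i)).2.1 γ hγ).2.1
  have hβ0 : ∀ i, 0 ≤ β i := fun i => hSpos i _ (hβ i).1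
  have hβlow : ∀ i, ((i.1 : ℝ) - 1) / 2 ≤ β i := fun i => hSlow i _ (hβ i).1
  have hN : ∀ i, ((S i).card - 1 : ℝ) ≤ (μ + k) * β i + c := fun i => by
    have h1 := (hlx i.1 _ (hmem i)).2.2.1
    have h2 := mul_le_mul_of_nonneg_left (hβlow i) (by linarith : 0 ≤ μ + k)
    exact h1.trans (add_le_add h2 (le_abs_self _))
  have hbnorm : ∀ i, ‖b i‖ ≤ K * (i.1 + 1) * B ^ i.1 := fun i => (hlx i.1 _ (hmem i)).2.2.2
  have hfinlow : ∀ Y : ℝ, {i : Σ m, Fin (n m) | ((i.1 : ℝ) - 1) / 2 ≤ Y}.Finite := by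
    intro Y
    refine (finite_sigma_fin n (⌈2 * Y + 1⌉₊ + 1)).subset fun i hi => ?_
    have h1 : ((i.1 : ℝ) - 1) / 2 ≤ Y := hi
    have h2 : (i.1 : ℝ) ≤ ⌈2 * Y + 1⌉₊ := le_trans (by linarith) (Nat.le_ceil _)
    have h3 : i.1 ≤ ⌈2 * Y + 1⌉₊ := by exact_mod_cast h2
    exact Nat.lt_succ_of_le h3
  -- the window sums
  have hsumF : ∀ (M : ℕ) (f : ℝ → ℂ),
      ∑ i ∈ (Finset.range M).sigma fun m => (Finset.univ : Finset (Fin (n m))),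
        b i * ((((S i).card - 1).factorial : ℂ) * divDiff (S i) f) = cutError hR A k L M f := by
    intro M f
    rw [Finset.sum_sigma]
    have h1 : ∀ m, ∑ j : Fin (n m), b ⟨m, j⟩ * ((((S ⟨m, j⟩).card - 1).factorial : ℂ) *
        divDiff (S ⟨m, j⟩) f) = cutError hR A k L (m + 1) f - cutError hR A k L m f := by
      intro m
      rw [← hlsum m f, ← List.sum_ofFn]
      congr 1
      exact List.ofFn_getElem_eq_map (l m) fun x : Finset ℝ × ℂ =>
        x.2 * (((x.1.card - 1).factorial : ℂ) * divDiff x.1 f)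
    rw [Finset.sum_congr rfl fun m _ => h1 m, Finset.sum_range_sub (fun m => cutError hR A k L m f),
      cutError_zero, sub_zero]
  -- the radius
  set s := Real.log (8 * B) with hs
  have hB8 : (1 : ℝ) < 8 * B := by linarith
  have hs0 : 0 < s := Real.log_pos hB8
  -- Thus r = (8B)^{-2}. As β ≥ (m-1)/2 in window `m`, r^β is at most a constant times (8B)^{-m},
  -- which turns the growth B^m into 8^{-m}.
  set r := Real.exp (-(2 * s)) with hr
  have hr0 : 0 < r := Real.exp_pos _
  have hr1 : r < 1 := Real.exp_lt_one_iff.2 (by linarith)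
  have hrpow : ∀ x : ℝ, r ^ x = Real.exp (-(2 * s) * x) := fun x => (Real.exp_mul _ _).symm
  set u : (Σ m, Fin (n m)) → ℝ := fun i => ‖b i‖ * r ^ β i with hu
  have hu0 : ∀ i, 0 ≤ u i := fun i => by positivity
  have hus : Summable u := by
    refine summable_sigma_fin n u (C₁ := 3 * L) (C₂ := K * (8 * B)) (by positivity)
      (fun m => hllen m) hu0 fun i => ?_
    have h1 : r ^ β i ≤ (8 * B) * ((8 * B)⁻¹) ^ i.1 := by
      have h2 : (8 * B) * ((8 * B)⁻¹) ^ i.1 = Real.exp (-(2 * s) * (((i.1 : ℝ) - 1) / 2)) := by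
        have h3 : 8 * B = Real.exp s := (Real.exp_log (by linarith)).symm
        rw [h3, ← Real.exp_neg, ← Real.exp_nat_mul, ← Real.exp_add]
        congr 1
        ring
      rw [h2, hrpow]
      exact Real.exp_le_exp.2 (mul_le_mul_of_nonpos_left (hβlow i) (by linarith))
    calc u i ≤ (K * (i.1 + 1) * B ^ i.1) * ((8 * B) * ((8 * B)⁻¹) ^ i.1) :=
          mul_le_mul (hbnorm i) h1 (by positivity) (by positivity)
      _ = K * (8 * B) * (i.1 + 1) * (B * (8 * B)⁻¹) ^ i.1 := by
          rw [mul_pow]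
          ring
      _ = _ := by
          congr 2
          field_simp
  -- the domain
  set κ := μ + 2 * k with hκ
  have hκ0 : 0 < κ := by linarith
  have hkκ : k ≤ κ := by linarith
  -- The bound -2s = log r gives e^{βa₁} ≤ r^β; the last entry forces Re w < -1, hence |w| ≥ 1.
  set a₁ := min (min a (-(2 * s))) (-1 + κ * Real.log κ) with ha₁
  have ha₁a : a₁ ≤ a := (min_le_left _ _).trans (min_le_left _ _)
  have ha₁s : a₁ ≤ -(2 * s) := (min_le_left _ _).trans (min_le_right _ _)
  have hdom : ∀ w ∈ logHalfPlane a₁ κ, w.re ≤ 0 ∧ 1 ≤ ‖w‖ ∧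
      w.re + κ * Real.log ‖w‖ ≤ -(2 * s) := by
    intro w hw
    have h1 := re_lt_of_mem_logHalfPlane hκ0 hw (min_le_right _ _)
    have h2 := Complex.abs_re_le_norm w
    rw [abs_of_neg (by linarith)] at h2
    exact ⟨by linarith, by linarith, ((mem_logHalfPlane_iff.1 hw).2.le).trans ha₁s⟩
  have hsubset : ∀ a' ≤ a₁, logHalfPlane a' κ ⊆ logHalfPlane a₁ κ := fun a' ha' w hw => by
    rw [mem_logHalfPlane_iff] at hw ⊢
    exact ⟨hw.1, hw.2.trans_le ha'⟩
  have hsub : logHalfPlane a₁ κ ⊆ logHalfPlane a k := fun w hw => by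
    obtain ⟨-, h2, -⟩ := hdom w hw
    rw [mem_logHalfPlane_iff] at hw ⊢
    refine ⟨by linarith [hw.1], ?_⟩
    have := mul_le_mul_of_nonneg_right hkκ (Real.log_nonneg h2)
    linarith [hw.2]
  -- bounds for the packages
  have hpack : ∀ X : ℝ, ∀ i, c + κ * X ≤ k * β i → ∀ w ∈ logHalfPlane a₁ κ,
      ‖b i * vandermondePackage (S i) w‖ ≤ r ^ (-X) * Real.exp (X * w.re) * u i := by
    intro X i hi w hw
    obtain ⟨h1, h2, h3⟩ := hdom w hw
    -- The slack kβ between (μ+k)β and (μ+2k)β absorbs both `c` and the loss κX.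
    have h4 := norm_vandermondePackage_le_exp (S i) (β i) (hβ i) (X := X) hκ0
      ((hN i).trans (by rw [hκ] at hi ⊢; linarith)) w h2 h1 h3
    have h5 : Real.exp ((β i - X) * -(2 * s)) = r ^ (-X) * r ^ β i := by
      rw [hrpow, hrpow, ← Real.exp_add]
      congr 1
      ring
    rw [h5] at h4
    rw [norm_mul]
    calc _ ≤ ‖b i‖ * (Real.exp (X * w.re) * (r ^ (-X) * r ^ β i)) := by gcongr
      _ = _ := by
        simp only [hu]
        ring
  set v : (Σ m, Fin (n m)) → ℝ := fun i => if c ≤ k * β i then u i else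
    ‖b i‖ * ∑ γ ∈ S i, |normalizedVandermondeCoeff (S i) γ| with hv
  have hvs : Summable v := by
    refine hus.congr_cofinite ?_
    refine (hfinlow (c / k)).subset fun i hi => ?_
    by_contra h
    refine hi ?_
    have h1 : c / k < ((i.1 : ℝ) - 1) / 2 := not_le.1 h
    have h2 := h1.trans_le (hβlow i)
    rw [div_lt_iff₀ hk] at h2
    have h3 : c ≤ k * β i := by linarith
    exact (if_pos h3).symm
  have hvb : ∀ w ∈ logHalfPlane a₁ κ, ∀ i, ‖b i * vandermondePackage (S i) w‖ ≤ v i := by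
    intro w hw i
    simp only [hv]
    split_ifs with h
    · simpa using hpack 0 i (by simpa using h) w hw
    · rw [norm_mul]
      exact mul_le_mul_of_nonneg_left
        (norm_vandermondePackage_le_sum (S i) (hSpos i) w (hdom w hw).1) (norm_nonneg _)
  -- the difference of `g` and the sum of the packages is flat
  set G : ℂ → ℂ := fun w => ∑' i, b i * vandermondePackage (S i) w with hG
  have hGs : ∀ w ∈ logHalfPlane a₁ κ, Summable fun i => b i * vandermondePackage (S i) w :=
    fun w hw => Summable.of_norm_bounded hvs (hvb w hw)
  have hGd : DifferentiableOn ℂ G (logHalfPlane a₁ κ) :=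
    Complex.differentiableOn_tsum_of_summable_norm hvs
      (fun i => ((differentiable_vandermondePackage (S i)).const_mul _).differentiableOn)
      (isOpen_logHalfPlane a₁ hκ0.le) (fun i w hw => hvb w hw i)
  obtain ⟨M₀, hM₀⟩ := hg.bounded
  have hflat : ∀ X : ℕ, ∃ C Y : ℝ, ∀ w ∈ logHalfPlane a₁ κ, w.re ≤ Y →
      ‖g w - G w‖ ≤ C * Real.exp (X * w.re) := by
    intro X
    set F := (hR.finite_inter_Iio X).toFinset with hF
    have hFc : (F : Set ℝ) = R ∩ Iio (X : ℝ) := by simp [hF]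
    obtain ⟨C₁, Y, hC₁⟩ := hg.development.exists_bound X F hFc
    -- From window `M` on, β ≥ (M-1)/2 gives kβ ≥ c + κX, so `hpack` covers the whole tail; also X ≤
    -- (M-1)/2, as the comparison of `cutError` with the formal series requires.
    set M := ⌈2 * X + 2 * (c + κ * X) / k⌉₊ + 1 with hM
    have hMle : 2 * X + 2 * (c + κ * X) / k ≤ (M : ℝ) - 1 := by
      rw [hM]
      push_cast
      linarith [Nat.le_ceil (2 * X + 2 * (c + κ * X) / k)]
    have hq0 : 0 ≤ 2 * (c + κ * X) / k := by positivity
    have hX0 : (0 : ℝ) ≤ X := X.cast_nonneg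
    obtain ⟨C₂, hC₂0, hC₂⟩ := exists_norm_cutError_sub_le hR A k hL M (X := X) (by linarith) F hFc
    set I := (Finset.range M).sigma fun m => (Finset.univ : Finset (Fin (n m))) with hI
    refine ⟨C₁ + C₂ + r ^ (-(X : ℝ)) * ∑' i, u i, Y, fun w hw hwY => ?_⟩
    obtain ⟨h1, h2, h3⟩ := hdom w hw
    set f : ℝ → ℂ := fun t => Complex.exp (t * w) with hf
    have e1 := hC₁ w (hsub hw) hwY
    have e2 := hC₂ f (Real.exp (X * w.re)) (fun t ht => by
      simp only [hf]
      rw [Complex.norm_exp, Complex.re_ofReal_mul]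
      exact Real.exp_le_exp.2 (mul_le_mul_of_nonpos_right ht h1))
    have hI' : ∑ i ∈ I, b i * vandermondePackage (S i) w = cutError hR A k L M f := by
      rw [← hsumF M f]
      refine Finset.sum_congr rfl fun i _ => ?_
      have hc' : 0 < (S i).card := Finset.card_pos.2 (hne i)
      rw [vandermondePackage_eq (S i) ((S i).card - 1) (by lia) w]
    have hsplit := (hGs w hw).sum_add_tsum_compl (s := I)
    rw [hI'] at hsplit
    have e3 : ‖∑' i : ((I : Set (Σ m, Fin (n m)))ᶜ : Set _), b i * vandermondePackage (S i) w‖ ≤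
        r ^ (-(X : ℝ)) * Real.exp (X * w.re) * ∑' i, u i := by
      have hus' := hus.subtype ((I : Set (Σ m, Fin (n m)))ᶜ : Set _)
      refine (tsum_of_norm_bounded (hus'.hasSum.mul_left (r ^ (-(X : ℝ)) * Real.exp (X * w.re)))
        fun i => hpack X i.1 ?_ w hw).trans ?_
      · have hi : M ≤ i.1.1 := by
          have h : i.1 ∉ I := i.2
          exact not_lt.1 fun h' => h (Finset.mem_sigma.2 ⟨Finset.mem_range.2 h', Finset.mem_univ _⟩)
        have hi' : (M : ℝ) ≤ i.1.1 := by exact_mod_cast hi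
        have h6 := hβlow i.1
        have h7 : (c + κ * X) / k ≤ β i.1 := by
          have : 2 * (c + κ * X) / k = 2 * ((c + κ * X) / k) := by ring
          linarith
        rw [div_le_iff₀ hk] at h7
        linarith
      · refine mul_le_mul_of_nonneg_left ?_ (by positivity)
        exact hus.tsum_subtype_le _ _ hu0
    have e4 : g w - G w = (g w - ∑ β ∈ F, A β * Complex.exp (β * w)) -
        (cutError hR A k L M f - ∑ β ∈ F, A β * f β) -
        ∑' i : ((I : Set (Σ m, Fin (n m)))ᶜ : Set _), b i * vandermondePackage (S i) w := by
      simp only [hG]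
      rw [← hsplit]
      ring
    rw [e4]
    refine (norm_sub_le _ _).trans ((add_le_add ((norm_sub_le _ _).trans (add_le_add e1 e2))
      e3).trans (le_of_eq ?_))
    ring
  obtain ⟨a', ha'a₁, ha'⟩ := exists_eqOn_zero_of_flat hκ0 (D := fun w => g w - G w)
    ((hg.holomorphic.mono hsub).sub hGd) (M := M₀ + ∑' i, v i) (fun w hw =>
      (norm_sub_le _ _).trans (add_le_add (hM₀ w (hsub hw))
        (tsum_of_norm_bounded hvs.hasSum (hvb w hw)))) hflat
  refine ⟨n, S, β, b, v, r, c, a', fun m => List.length_pos_iff.2 (hlne m), hβ, hSpos, ?_, ?_,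
    hr0, hr1, hus, ?_, (hsubset a' ha'a₁).trans hsub, ?_, hvs,
    fun w hw => hvb w (hsubset a' ha'a₁ hw), ?_⟩
  · intro Y
    refine (hfinlow Y).subset ?_
    rintro i ⟨γ, hγ, hγY⟩
    exact (hSlow i γ hγ).trans hγY
  · intro x hx
    have hx0 : 0 ≤ x := hR.nonneg hx
    have h1 := Nat.floor_le (by positivity : 0 ≤ 2 * x)
    have h2 := Nat.lt_floor_add_one (2 * x)
    obtain ⟨y, hy, hxy⟩ := hlcov ⌊2 * x⌋₊ x hx (by linarith) (by linarith)
    obtain ⟨j, hj⟩ := List.get_of_mem hy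
    refine mem_iUnion.2 ⟨⟨⌊2 * x⌋₊, j⟩, ?_⟩
    simp only [hS, hj]
    exact hxy
  · intro i
    have := mul_nonneg hk.le (hβ0 i)
    linarith [hN i]
  · intro γ
    -- Packages from window `M` on avoid γ, so the sum of the coefficients at γ is finite. It equals
    -- `cutError` of the indicator of γ, and the comparison with `δ = 0` gives A_γ or 0 exactly.
    set M := ⌈2 * |γ|⌉₊ + 3 with hM
    have hMγ : γ < ((M : ℝ) - 1) / 2 := by
      have h1 := Nat.le_ceil (2 * |γ|)
      have h2 := le_abs_self γ
      rw [hM]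
      push_cast
      linarith
    have hind : ∀ i, (S i : Set ℝ).indicator
        (fun γ => b i * (normalizedVandermondeCoeff (S i) γ : ℂ)) γ =
        b i * ((((S i).card - 1).factorial : ℂ) * divDiff (S i) (Pi.single γ 1)) := by
      intro i
      by_cases h : γ ∈ S i
      · rw [indicator_of_mem (by exact_mod_cast h), divDiff, Finset.sum_eq_single γ
          (fun x _ hx => by simp [hx]) (fun hx => absurd h hx), normalizedVandermondeCoeff]
        simp
      · rw [indicator_of_notMem (by exact_mod_cast h), divDiff, Finset.sum_eq_zero fun x hx => ?_]
        · simp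
        · have : x ≠ γ := fun hxγ => h (hxγ ▸ hx)
          simp [this]
    simp_rw [hind]
    have hlim := hasSum_sum_of_ne_finset_zero (f := fun i =>
      b i * ((((S i).card - 1).factorial : ℂ) * divDiff (S i) (Pi.single γ 1)))
      (s := (Finset.range M).sigma fun m => (Finset.univ : Finset (Fin (n m)))) (L := .unconditional _)
      (fun i hi => by
        rw [← hind, indicator_of_notMem]
        intro hγ
        have hi' : M ≤ i.1 := by simpa using hi
        have hi'' : (M : ℝ) ≤ i.1 := by exact_mod_cast hi'
        have := hSlow i γ hγ
        linarith)
    rw [hsumF] at hlim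
    obtain ⟨C, -, hC⟩ := exists_norm_cutError_sub_le hR A k hL M le_rfl
      (hR.finite_inter_Iio (((M : ℝ) - 1) / 2)).toFinset (by simp)
    have h0 := hC (Pi.single γ 1) 0 (fun t ht => by
      have : t ≠ γ := by
        rintro rfl
        linarith
      simp [this])
    rw [mul_zero, norm_le_zero_iff, sub_eq_zero] at h0
    rw [h0] at hlim
    convert! hlim using 1
    by_cases h : γ ∈ R
    · rw [indicator_of_mem h, Finset.sum_eq_single γ (fun x _ hx => by simp [hx])]
      · simp
      · intro hx
        exact absurd ((hR.finite_inter_Iio (((M : ℝ) - 1) / 2)).mem_toFinset.2 ⟨h, hMγ⟩) hx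
    · rw [indicator_of_notMem h, Finset.sum_eq_zero fun x hx => ?_]
      rw [Set.Finite.mem_toFinset] at hx
      have : x ≠ γ := fun hxγ => h (hxγ ▸ hx.1)
      simp [this]
  · intro w hw
    have h1 := (hGs w (hsubset a' ha'a₁ hw)).hasSum
    have h2 : g w = G w := sub_eq_zero.1 (ha' w hw)
    rw [h2]
    exact h1

end

end IrrationalSeries

open IrrationalSeries in
theorem theorem4p1 (R : Set ℝ) (hR : IsExponentSet R) (A : ℝ → ℂ) (a k : ℝ) (hk : 0 < k)
    (g : ℂ → ℂ) (hg : IsIrrationalSeries g (logHalfPlane a k) R A)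
    (μ ν : ℝ) (hdens : HasLinearDensity R μ ν) :
    ∃ (S : ℕ → Finset ℝ) (β : ℕ → ℝ) (N : ℕ → ℕ) (b : ℕ → ℂ) (r c a' : ℝ) (R' : Set ℝ),
      (∀ n, IsLeast (S n : Set ℝ) (β n)) ∧
      (∀ n, (S n).card = N n + 1) ∧
      0 < r ∧ r < 1 ∧
      Summable (fun n => ‖b n‖ * r ^ β n) ∧
      (∀ n, (N n : ℝ) ≤ (μ + 2 * k) * β n + c) ∧
      logHalfPlane a' (μ + 2 * k) ⊆ logHalfPlane a k ∧
      (∀ w ∈ logHalfPlane a' (μ + 2 * k),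
        HasSum (fun n => b n * vandermondePackage (S n) w) (g w)) ∧
      IsExponentSet R' ∧
      IsDecomposition S (fun n γ => b n * (normalizedVandermondeCoeff (S n) γ : ℂ)) R' R A ∧
      ConvergesNormallyByPackages S (fun n γ => b n * (normalizedVandermondeCoeff (S n) γ : ℂ))
        (logHalfPlane a' (μ + 2 * k)) := by
  obtain ⟨n, S, β, b, v, r, c, a', hn, hβ, hSpos, hfin, hcov, hr0, hr1, hus, hN, hsub, hcoeff, hvs,
    hvb, hsum⟩ := exists_package_family R hR A a k hk g hg μ ν hdens
  -- Every window contributes at least one package, so the index set is infinite and can be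
  -- enumerated by ℕ without padding.
  have : Infinite (Σ m, Fin (n m)) :=
    Infinite.of_injective (fun m => (⟨m, ⟨0, hn m⟩⟩ : Σ m, Fin (n m))) fun m m' h =>
      congrArg Sigma.fst h
  obtain ⟨e⟩ : Nonempty (ℕ ≃ Σ m, Fin (n m)) :=
    (nonempty_denumerable (Σ m, Fin (n m))).map fun h =>
      (@Denumerable.eqv _ h).symm
  have hcard : ∀ i, 0 < (S i).card := fun i => Finset.card_pos.2 ⟨_, (hβ i).1⟩
  have hunion : ⋃ m, (S (e m) : Set ℝ) = ⋃ i, (S i : Set ℝ) :=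
    e.surjective.iUnion_comp fun i => (S i : Set ℝ)
  refine ⟨fun m => S (e m), fun m => β (e m), fun m => (S (e m)).card - 1, fun m => b (e m), r, c,
    a', ⋃ i, (S i : Set ℝ), fun m => hβ _, fun m => ?_, hr0, hr1, ?_, fun m => ?_, hsub, ?_,
    isExponentSet_iUnion S hSpos hfin, ⟨hcov, hunion, fun γ _ => ?_⟩, ?_⟩
  · have := hcard (e m)
    lia
  · exact hus.comp_injective e.injective
  · have := hN (e m)
    simp only
    rw [Nat.cast_sub (hcard (e m))]
    simpa using this
  · intro w hw
    exact (e.hasSum_iff (f := fun i => b i * vandermondePackage (S i) w)).2 (hsum w hw)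
  · exact (e.hasSum_iff (f := fun i => (S i : Set ℝ).indicator
      (fun γ => b i * (normalizedVandermondeCoeff (S i) γ : ℂ)) γ)).2 (hcoeff γ)
  · refine lt_of_le_of_lt (ENNReal.tsum_le_tsum fun m => ?_)
      (hvs.comp_injective e.injective).tsum_ofReal_lt_top
    refine iSup₂_le fun w hw => ?_
    have h1 : package (S (e m)) (fun γ => b (e m) * (normalizedVandermondeCoeff (S (e m)) γ : ℂ)) w =
        b (e m) * vandermondePackage (S (e m)) w := by
      simp only [vandermondePackage, package, Finset.mul_sum, mul_assoc]
    rw [h1, ← ofReal_norm]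
    exact ENNReal.ofReal_le_ofReal (hvb w hw (e m))
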